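/- Lemma. For $m\ge 1$ let $\mathrm{Sp}(m,\mathbb R)$ be the Lie group of real symplectic $2m\times 2m$ matrices and let $\widetilde{\mathrm{Sp}}(m,\mathbb R)$ be its simply connected universal covering group. Let $n\ge 1$ and let $\rho:\widetilde{\mathrm{Sp}}(n,\mathbb R)\times\widetilde{\mathrm{Sp}}(1,\mathbb R)\to\widetilde{\mathrm{Sp}}(n+1,\mathbb R)$ be a homomorphism of Lie groups which is an immersion. Then the centralizer in $\widetilde{\mathrm{Sp}}(n+1,\mathbb R)$ of the image of $\rho$ contains the center of $\widetilde{\mathrm{Sp}}(n+1,\mathbb R)$ as a subgroup of finite index. -/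

import Mathlib

open scoped Manifold ContDiff

section UniversalCover

open scoped Topology unitInterval

variable (G : Type*) [TopologicalSpace G] [Group G] [IsTopologicalGroup G]

/-- The group, under pointwise multiplication, of the continuous paths `[0, 1] → G` that start at
the identity. As a subspace of `C(I, G)` it carries the compact-open topology. -/
def basedPaths : Subgroup C(I, G) where
  carrier := {γ | γ 0 = 1}
  one_mem' := rfl
  mul_mem' {γ δ} hγ hδ := by
    change γ 0 * δ 0 = 1
    rw [show γ 0 = 1 from hγ, show δ 0 = 1 from hδ, one_mul]
  inv_mem' {γ} hγ := by
    change (γ 0)⁻¹ = 1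
    rw [show γ 0 = 1 from hγ, inv_one]

/-- The subgroup of the loops at the identity that are homotopic, relative to the end points, to
the constant loop. Two paths from `1` are homotopic relative to their end points if and only if
they lie in the same coset of this subgroup. -/
def nullLoops : Subgroup (basedPaths G) where
  carrier := {γ | (γ : C(I, G)).HomotopicRel 1 {0, 1}}
  one_mem' := .refl 1
  mul_mem' {γ δ} hγ hδ := by
    obtain ⟨F⟩ := hγ
    obtain ⟨F'⟩ := hδ
    refine ⟨⟨⟨F.toContinuousMap * F'.toContinuousMap, fun x => ?_, fun x => ?_⟩, fun t x hx => ?_⟩⟩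
    · change F (0, x) * F' (0, x) = _
      simp
    · change F (1, x) * F' (1, x) = _
      simp
    · change F (t, x) * F' (t, x) = _
      rw [F.eq_fst t hx, F'.eq_fst t hx]; rfl
  inv_mem' {γ} hγ := by
    obtain ⟨F⟩ := hγ
    refine ⟨⟨⟨F.toContinuousMap⁻¹, fun x => ?_, fun x => ?_⟩, fun t x hx => ?_⟩⟩
    · change (F (0, x))⁻¹ = _
      simp
    · change (F (1, x))⁻¹ = _
      simp
    · change (F (t, x))⁻¹ = _
      rw [F.eq_fst t hx]; rfl

instance : (nullLoops G).Normal where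
  conj_mem γ hγ δ := by
    obtain ⟨F⟩ := hγ
    have hc : Continuous fun p : I × I => δ.1 p.2 * F p * (δ.1 p.2)⁻¹ := by fun_prop
    refine ⟨⟨⟨⟨fun p => δ.1 p.2 * F p * (δ.1 p.2)⁻¹, hc⟩, fun x => ?_, fun x => ?_⟩,
      fun t x hx => ?_⟩⟩
    · simp
    · simp
    · change δ.1 x * F (t, x) * (δ.1 x)⁻¹ = _
      rw [F.eq_fst t hx]; rfl

instance : IsTopologicalGroup C(I, G) where
  continuous_inv := ContinuousMap.continuous_postcomp ⟨fun g : G => g⁻¹, continuous_inv⟩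

/-- The universal covering group of a (connected, locally simply connected) topological group:
homotopy classes relative to the end points of the paths that start at the identity, with the
pointwise multiplication and the quotient of the compact-open topology. -/
def UniversalCover : Type _ := basedPaths G ⧸ nullLoops G

noncomputable instance : Group (UniversalCover G) :=
  inferInstanceAs (Group (basedPaths G ⧸ nullLoops G))

instance : TopologicalSpace (UniversalCover G) :=
  inferInstanceAs (TopologicalSpace (basedPaths G ⧸ nullLoops G))

instance : IsTopologicalGroup (UniversalCover G) :=
  inferInstanceAs (IsTopologicalGroup (basedPaths G ⧸ nullLoops G))

namespace UniversalCover

/-- The homotopy class of a path. -/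
def mk : basedPaths G →* UniversalCover G := QuotientGroup.mk' (nullLoops G)

/-- The covering homomorphism: it sends the class of a path to its end point. -/
def proj : UniversalCover G →* G :=
  QuotientGroup.lift (nullLoops G)
    { toFun := fun γ => γ.1 1, map_one' := rfl, map_mul' := fun _ _ => rfl }
    (fun γ hγ => hγ.fst_eq_snd (x := 1) (by simp))

variable {G}

@[simp] theorem proj_mk (γ : basedPaths G) : proj G (mk G γ) = γ.1 1 := rfl

theorem mk_surjective : Function.Surjective (mk G) := QuotientGroup.mk'_surjective _

theorem continuous_mk : Continuous (mk G) := continuous_quot_mk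

theorem isOpenMap_mk : IsOpenMap (mk G) := QuotientGroup.isOpenMap_coe

theorem continuous_proj : Continuous (proj G) := by
  refine Continuous.quotient_lift (s := QuotientGroup.leftRel (nullLoops G)) 
    (f := fun γ : basedPaths G => γ.1 1) ?_ _
  exact (continuous_eval_const (1 : I)).comp continuous_subtype_val

theorem mk_eq_mk_of_homotopicRel {γ δ : basedPaths G}
    (h : (γ : C(I, G)).HomotopicRel δ {0, 1}) : mk G γ = mk G δ := by
  obtain ⟨F⟩ := h
  symm
  refine (QuotientGroup.eq (s := nullLoops G)).2 ?_
  have hc : Continuous fun p : I × I => (δ.1 p.2)⁻¹ * F p := by fun_prop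
  refine ⟨⟨⟨⟨fun p => (δ.1 p.2)⁻¹ * F p, hc⟩, fun x => ?_, fun x => ?_⟩, fun t x hx => ?_⟩⟩
  · simp
  · simp
  · change (δ.1 x)⁻¹ * F (t, x) = _
    rw [F.eq_fst t hx]; rfl

/-! ### The chart at the identity -/

variable {E : Type*} [NormedAddCommGroup E] [NormedSpace ℝ E]

/-- The path `t ↦ φ⁻¹(t X)`, where `φ` is a chart of `G` centred at `1` with image a ball. -/
def ray (φ : OpenPartialHomeomorph G E) {r : ℝ} (hr : φ.target = Metric.ball 0 r)
    (h1 : φ.symm 0 = 1) (X : Metric.ball (0 : E) r) : basedPaths G :=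
  ⟨⟨fun t => φ.symm ((t : ℝ) • (X : E)), by
    refine φ.continuousOn_symm.comp_continuous (by fun_prop) fun t => ?_
    rw [hr, mem_ball_zero_iff, norm_smul, Real.norm_of_nonneg t.2.1]
    exact (mul_le_of_le_one_left (norm_nonneg _) t.2.2).trans_lt (mem_ball_zero_iff.1 X.2)⟩,
    by change φ.symm _ = 1; simpa using h1⟩

theorem continuous_ray (φ : OpenPartialHomeomorph G E) {r : ℝ} (hr : φ.target = Metric.ball 0 r)
    (h1 : φ.symm 0 = 1) : Continuous (ray φ hr h1) := by
  refine Continuous.subtype_mk ?_ _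
  refine ContinuousMap.continuous_of_continuous_uncurry _ ?_
  refine φ.continuousOn_symm.comp_continuous
    (f := fun p : Metric.ball (0 : E) r × I => (p.2 : ℝ) • (p.1 : E)) (by fun_prop) fun p => ?_
  rw [hr, mem_ball_zero_iff, norm_smul, Real.norm_of_nonneg p.2.2.1]
  exact (mul_le_of_le_one_left (norm_nonneg _) p.2.2.2).trans_lt (mem_ball_zero_iff.1 p.1.2)

open Classical in
/-- A chart `φ` of `G` centred at `1`, with image a ball, lifts to a chart of the universal cover
centred at `1`: it sends the class of a path that stays in the domain of `φ` to the `φ`-coordinate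
of its end point, and its inverse sends `X` to the class of the path `t ↦ φ⁻¹(t X)`. -/
noncomputable def liftChart (φ : OpenPartialHomeomorph G E) {r : ℝ}
    (hr : φ.target = Metric.ball 0 r)
    (h1 : φ.symm 0 = 1) : OpenPartialHomeomorph (UniversalCover G) E where
  toFun x := φ (proj G x)
  invFun X := if h : X ∈ Metric.ball (0 : E) r then mk G (ray φ hr h1 ⟨X, h⟩) else 1
  source := mk G '' {γ | ∀ t, γ.1 t ∈ φ.source}
  target := Metric.ball 0 r
  map_source' := by
    rintro _ ⟨γ, hγ, rfl⟩
    rw [← hr]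
    exact φ.map_source (hγ 1)
  map_target' X hX := by
    rw [dif_pos hX]
    refine ⟨_, fun t => φ.map_target ?_, rfl⟩
    rw [hr, mem_ball_zero_iff, norm_smul, Real.norm_of_nonneg t.2.1]
    exact (mul_le_of_le_one_left (norm_nonneg _) t.2.2).trans_lt (mem_ball_zero_iff.1 hX)
  left_inv' := by
    rintro _ ⟨γ, hγ, rfl⟩
    have hX : φ (proj G (mk G γ)) ∈ Metric.ball (0 : E) r := hr ▸ φ.map_source (hγ 1)
    rw [dif_pos hX]
    symm
    apply mk_eq_mk_of_homotopicRel
    have hmem : ∀ p : I × I, (1 - (p.1 : ℝ)) • φ (γ.1 p.2) +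
        (p.1 : ℝ) • ((p.2 : ℝ) • φ (γ.1 1)) ∈ φ.target := by
      intro p
      have h2 : ((p.2 : ℝ) • φ (γ.1 1)) ∈ Metric.ball (0 : E) r := by
        rw [mem_ball_zero_iff, norm_smul, Real.norm_of_nonneg p.2.2.1]
        exact (mul_le_of_le_one_left (norm_nonneg _) p.2.2.2).trans_lt (mem_ball_zero_iff.1 hX)
      rw [hr]
      exact convex_ball (0 : E) r (hr ▸ φ.map_source (hγ p.2)) h2 (sub_nonneg.2 p.1.2.2) p.1.2.1
        (by ring)
    have hφ : Continuous fun t : I => φ (γ.1 t) :=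
      φ.continuousOn.comp_continuous γ.1.continuous hγ
    have hc : Continuous fun p : I × I => φ.symm ((1 - (p.1 : ℝ)) • φ (γ.1 p.2) +
        (p.1 : ℝ) • ((p.2 : ℝ) • φ (γ.1 1))) := by
      refine φ.continuousOn_symm.comp_continuous ?_ hmem
      have h2 : Continuous fun p : I × I => φ (γ.1 p.2) := hφ.comp continuous_snd
      exact ((continuous_const.sub (continuous_subtype_val.comp continuous_fst)).smul h2).add
        ((continuous_subtype_val.comp continuous_fst).smul
          ((continuous_subtype_val.comp continuous_snd).smul continuous_const))
    have hγ0 : γ.1 0 = 1 := γ.2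
    have hφ1 : φ 1 = 0 := by
      rw [← h1]
      exact φ.right_inv (hr ▸ Metric.mem_ball_self ((norm_nonneg _).trans_lt
        (mem_ball_zero_iff.1 hX)))
    refine ⟨⟨⟨⟨_, hc⟩, fun x => ?_, fun x => ?_⟩, fun t x hx => ?_⟩⟩
    · simp [φ.left_inv (hγ x)]
    · simp [ray]
    · rcases hx with rfl | rfl
      · simp [hγ0, hφ1, h1]
      · change φ.symm ((1 - (t : ℝ)) • φ (γ.1 1) + (t : ℝ) • ((1 : ℝ) • φ (γ.1 1))) = γ.1 1
        rw [one_smul, ← add_smul, sub_add_cancel, one_smul, φ.left_inv (hγ 1)]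
  right_inv' X hX := by
    rw [dif_pos hX]
    simp [ray, φ.right_inv (show X ∈ φ.target from hr ▸ hX)]
  open_source := by
    refine isOpenMap_mk _ ?_
    have : {γ : basedPaths G | ∀ t, γ.1 t ∈ φ.source} =
        Subtype.val ⁻¹' {f : C(I, G) | Set.MapsTo f Set.univ φ.source} := by
      ext γ; simp [Set.MapsTo]
    rw [this]
    exact (ContinuousMap.isOpen_setOfPred_mapsTo isCompact_univ φ.open_source).preimage
      continuous_subtype_val
  open_target := Metric.isOpen_ball
  continuousOn_toFun := by
    refine φ.continuousOn.comp continuous_proj.continuousOn ?_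
    rintro _ ⟨γ, hγ, rfl⟩
    exact hγ 1
  continuousOn_invFun := by
    rw [continuousOn_iff_continuous_domRestrict]
    have : (Metric.ball (0 : E) r).domRestrict (fun X : E =>
        if h : X ∈ Metric.ball (0 : E) r then mk G (ray φ hr h1 ⟨X, h⟩) else 1) =
        fun X => mk G (ray φ hr h1 X) := by
      funext X
      rw [Set.domRestrict_apply, dif_pos X.2]
    rw [this]
    exact continuous_mk.comp (continuous_ray φ hr h1)

end UniversalCover
end UniversalCover

section Symplectic

open Matrix

/-- The real symplectic group `Sp(n, ℝ)` of `2n × 2n` matrices, with the topology of matrices. -/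
abbrev Sp (n : ℕ) : Type := symplecticGroup (Fin n) ℝ

instance (n : ℕ) : IsTopologicalGroup (Sp n) where
  continuous_inv := by
    refine Continuous.subtype_mk ?_ _
    fun_prop

/-- The operators on the Euclidean space `ℝ²ⁿ`, with the operator norm. -/
abbrev SpOp (n : ℕ) : Type :=
  EuclideanSpace ℝ (Fin n ⊕ Fin n) →L[ℝ] EuclideanSpace ℝ (Fin n ⊕ Fin n)

/-- The identification of the `2n × 2n` matrices with the operators on `ℝ²ⁿ`. -/
noncomputable def toOp (n : ℕ) : Matrix (Fin n ⊕ Fin n) (Fin n ⊕ Fin n) ℝ ≃ₐ[ℝ] SpOp n :=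
  (Matrix.toEuclideanCLM (n := Fin n ⊕ Fin n) (𝕜 := ℝ)).toAlgEquiv

theorem continuous_toOp (n : ℕ) : Continuous (toOp n) :=
  LinearMap.continuous_of_finiteDimensional (toOp n).toLinearMap

theorem continuous_toOp_symm (n : ℕ) : Continuous (toOp n).symm :=
  LinearMap.continuous_of_finiteDimensional (toOp n).symm.toLinearMap

/-- The space of the matrices `X` with `Xᵀ J + J X = 0`, regarded as operators on `ℝ²ⁿ`. -/
noncomputable def spSubmodule (n : ℕ) : Submodule ℝ (SpOp n) :=
  (skewAdjointMatricesSubmodule (J (Fin n) ℝ)).comap (toOp n).symm.toLinearMap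

/-- The space `𝔰𝔭(n, ℝ)` of the matrices `X` with `Xᵀ J + J X = 0`, with the operator norm (the
choice of the norm plays no role). -/
def SpLie (n : ℕ) : Type := spSubmodule n

namespace SpLie

noncomputable instance (n : ℕ) : NormedAddCommGroup (SpLie n) :=
  inferInstanceAs (NormedAddCommGroup (spSubmodule n))

noncomputable instance (n : ℕ) : NormedSpace ℝ (SpLie n) :=
  inferInstanceAs (NormedSpace ℝ (spSubmodule n))

instance (n : ℕ) : FiniteDimensional ℝ (SpLie n) :=
  inferInstanceAs (FiniteDimensional ℝ (spSubmodule n))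

/-- The inclusion of `𝔰𝔭(n, ℝ)` into the space of operators. -/
noncomputable def incl (n : ℕ) : SpLie n →L[ℝ] SpOp n := (spSubmodule n).subtypeL

noncomputable instance (n : ℕ) : CoeOut (SpLie n) (SpOp n) := ⟨incl n⟩

end SpLie

variable {n : ℕ}

local notation "Mat" => Matrix (Fin n ⊕ Fin n) (Fin n ⊕ Fin n) ℝ

/-! ### The Cayley transform -/

section Cayley

variable {R : Type*} [Ring R]

/-- The Cayley transform `A ↦ (1 - A)(1 + A)⁻¹`. It is an involution, and it
exchanges the symplectic matrices and the elements of the symplectic Lie algebra. -/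
noncomputable def cayley (A : R) : R := (1 - A) * Ring.inverse (1 + A)

theorem cayley_mul {A : R} (h : IsUnit (1 + A)) : cayley A * (1 + A) = 1 - A := by
  rw [cayley, mul_assoc, Ring.inverse_mul_cancel _ h, mul_one]

theorem cayley_zero : cayley (0 : R) = 1 := by simp [cayley]

variable [Algebra ℝ R]

theorem one_add_cayley_mul {A : R} (h : IsUnit (1 + A)) :
    (1 + cayley A) * (1 + A) = (2 : ℝ) • 1 := by
  rw [add_mul, cayley_mul h, two_smul, one_mul]; abel

theorem isUnit_one_add_cayley {A : R} (h : IsUnit (1 + A)) : IsUnit (1 + cayley A) := by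
  have h2 : IsUnit ((2 : ℝ) • (1 : R)) := by
    rw [← Algebra.algebraMap_eq_smul_one]
    exact (isUnit_iff_ne_zero.2 two_ne_zero).map (algebraMap ℝ R)
  rw [← one_add_cayley_mul h] at h2
  obtain ⟨u, hu⟩ := h
  rw [← hu, Units.isUnit_mul_units] at h2
  exact h2

theorem cayley_cayley {A : R} (h : IsUnit (1 + A)) : cayley (cayley A) = A := by
  have h1 := cayley_mul (isUnit_one_add_cayley h)
  have h2 := congrArg (· * (1 + A)) h1
  simp only [mul_assoc, one_add_cayley_mul h, sub_mul, cayley_mul h] at h2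
  rw [mul_smul_comm, mul_one] at h2
  have h3 : (2 : ℝ) • cayley (cayley A) = (2 : ℝ) • A := by
    rw [h2, two_smul, one_mul]; abel
  have h4 := congrArg ((2⁻¹ : ℝ) • ·) h3
  simpa [smul_smul] using h4

end Cayley

theorem isUnit_one_add_toOp {A : Mat} : IsUnit (1 + toOp n A) ↔ IsUnit (1 + A) := by
  rw [← map_one (toOp n), ← map_add, MulEquiv.isUnit_map]

theorem cayley_toOp {A : Mat} (h : IsUnit (1 + A)) : cayley (toOp n A) = toOp n (cayley A) := by
  refine (isUnit_one_add_toOp.2 h).mul_right_cancel ?_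
  rw [cayley_mul (isUnit_one_add_toOp.2 h), ← map_one (toOp n), ← map_add, ← map_mul, ← map_sub,
    cayley_mul h]

theorem isUnit_one_add_symm {X : SpOp n} : IsUnit (1 + (toOp n).symm X) ↔ IsUnit (1 + X) := by
  rw [← isUnit_one_add_toOp, AlgEquiv.apply_symm_apply]

theorem toOp_cayley_symm {X : SpOp n} (h : IsUnit (1 + X)) :
    toOp n (cayley ((toOp n).symm X)) = cayley X := by
  rw [← cayley_toOp (isUnit_one_add_symm.2 h), AlgEquiv.apply_symm_apply]

theorem mem_sp_iff {X : Mat} : X ∈ skewAdjointMatricesSubmodule (J (Fin n) ℝ) ↔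
    Xᵀ * J (Fin n) ℝ = -(J (Fin n) ℝ * X) := by
  rw [mem_skewAdjointMatricesSubmodule, Matrix.IsSkewAdjoint, Matrix.IsAdjointPair, mul_neg]

theorem cayley_mem_symplecticGroup {X : Mat} (hX : X ∈ skewAdjointMatricesSubmodule (J (Fin n) ℝ))
    (h : IsUnit (1 + X)) : cayley X ∈ symplecticGroup (Fin n) ℝ := by
  rw [SymplecticGroup.mem_iff']
  rw [mem_sp_iff] at hX
  have ht : IsUnit (1 + X)ᵀ := by
    rw [Matrix.isUnit_iff_isUnit_det, det_transpose, ← Matrix.isUnit_iff_isUnit_det]; exact h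
  refine ht.mul_left_cancel (h.mul_right_cancel ?_)
  calc (1 + X)ᵀ * ((cayley X)ᵀ * J (Fin n) ℝ * cayley X) * (1 + X)
      = (cayley X * (1 + X))ᵀ * J (Fin n) ℝ * (cayley X * (1 + X)) := by
        rw [transpose_mul]; noncomm_ring
    _ = J (Fin n) ℝ - J (Fin n) ℝ * X - Xᵀ * J (Fin n) ℝ + Xᵀ * J (Fin n) ℝ * X := by
        rw [cayley_mul h, transpose_sub, transpose_one]; noncomm_ring
    _ = J (Fin n) ℝ + J (Fin n) ℝ * X + Xᵀ * J (Fin n) ℝ + Xᵀ * J (Fin n) ℝ * X := by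
        rw [hX]; noncomm_ring
    _ = _ := by rw [transpose_add, transpose_one]; noncomm_ring

theorem cayley_mem_sp {A : Mat} (hA : A ∈ symplecticGroup (Fin n) ℝ)
    (h : IsUnit (1 + A)) : cayley A ∈ skewAdjointMatricesSubmodule (J (Fin n) ℝ) := by
  rw [SymplecticGroup.mem_iff'] at hA
  rw [mem_sp_iff, ← sub_eq_zero, sub_neg_eq_add]
  have ht : IsUnit (1 + A)ᵀ := by
    rw [Matrix.isUnit_iff_isUnit_det, det_transpose, ← Matrix.isUnit_iff_isUnit_det]; exact h
  refine ht.mul_left_cancel (h.mul_right_cancel ?_)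
  calc (1 + A)ᵀ * ((cayley A)ᵀ * J (Fin n) ℝ + J (Fin n) ℝ * cayley A) * (1 + A)
      = (cayley A * (1 + A))ᵀ * J (Fin n) ℝ * (1 + A)
        + (1 + A)ᵀ * J (Fin n) ℝ * (cayley A * (1 + A)) := by
        rw [transpose_mul]; noncomm_ring
    _ = (2 : ℝ) • J (Fin n) ℝ - (2 : ℝ) • (Aᵀ * J (Fin n) ℝ * A) := by
        rw [cayley_mul h, transpose_sub, transpose_add, transpose_one, two_smul, two_smul]
        noncomm_ring
    _ = _ := by rw [hA]; simp

/-- The projection `M ↦ (M + J Mᵀ J) / 2` of the matrices onto the symplectic Lie algebra. -/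
noncomputable def spProjMatrix (M : Mat) : Mat :=
  (2⁻¹ : ℝ) • (M + J (Fin n) ℝ * Mᵀ * J (Fin n) ℝ)

theorem spProjMatrix_mem (M : Mat) : spProjMatrix M ∈ skewAdjointMatricesSubmodule (J (Fin n) ℝ) := by
  have hJ := J_squared (Fin n) ℝ
  rw [mem_sp_iff, spProjMatrix]
  simp only [transpose_smul, transpose_add, transpose_mul, J_transpose, transpose_transpose,
    smul_mul_assoc, mul_smul_comm, add_mul, mul_add, mul_neg, neg_mul, neg_neg]
  rw [← smul_neg]
  congr 1
  have e1 : J (Fin n) ℝ * (M * J (Fin n) ℝ) * J (Fin n) ℝ = - (J (Fin n) ℝ * M) := by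
    rw [mul_assoc, mul_assoc, hJ]; simp
  have e2 : J (Fin n) ℝ * (J (Fin n) ℝ * Mᵀ * J (Fin n) ℝ) = - (Mᵀ * J (Fin n) ℝ) := by
    rw [← mul_assoc, ← mul_assoc, hJ]; simp
  rw [e1, e2]
  abel

theorem spProjMatrix_add (M N : Mat) :
    spProjMatrix (M + N) = spProjMatrix M + spProjMatrix N := by
  simp only [spProjMatrix, transpose_add, mul_add, add_mul, smul_add]
  abel

theorem spProjMatrix_smul (c : ℝ) (M : Mat) : spProjMatrix (c • M) = c • spProjMatrix M := by
  simp only [spProjMatrix, transpose_smul, mul_smul_comm, smul_mul_assoc, smul_add, smul_comm c]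

theorem spProjMatrix_of_mem {X : Mat} (hX : X ∈ skewAdjointMatricesSubmodule (J (Fin n) ℝ)) : spProjMatrix X = X := by
  have hJ := J_squared (Fin n) ℝ
  rw [spProjMatrix, mul_assoc, mem_sp_iff.1 hX, mul_neg, ← mul_assoc, hJ, neg_mul, one_mul,
    neg_neg, ← two_smul ℝ, smul_smul]
  norm_num

theorem mem_spSubmodule {T : SpOp n} :
    T ∈ spSubmodule n ↔ (toOp n).symm T ∈ skewAdjointMatricesSubmodule (J (Fin n) ℝ) := Iff.rfl

/-- The projection onto the symplectic Lie algebra, as a linear map. -/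
noncomputable def spProjLinear (n : ℕ) : SpOp n →ₗ[ℝ] SpLie n where
  toFun T := ⟨toOp n (spProjMatrix ((toOp n).symm T)), by
    rw [mem_spSubmodule, AlgEquiv.symm_apply_apply]
    exact spProjMatrix_mem ((toOp n).symm T)⟩
  map_add' S T := Subtype.ext (by
    change toOp n (spProjMatrix ((toOp n).symm (S + T))) =
      toOp n (spProjMatrix ((toOp n).symm S)) + toOp n (spProjMatrix ((toOp n).symm T))
    rw [map_add, spProjMatrix_add, map_add])
  map_smul' c T := Subtype.ext (by
    change toOp n (spProjMatrix ((toOp n).symm (c • T))) =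
      c • toOp n (spProjMatrix ((toOp n).symm T))
    rw [map_smul, spProjMatrix_smul, map_smul])

/-- The projection onto the symplectic Lie algebra, as a continuous linear map. -/
noncomputable def spProj (n : ℕ) : SpOp n →L[ℝ] SpLie n :=
  LinearMap.toContinuousLinearMap (spProjLinear n)

theorem spProj_of_mem {T : SpOp n} (h : T ∈ spSubmodule n) : (spProj n T : SpOp n) = T := by
  change toOp n (spProjMatrix ((toOp n).symm T)) = T
  rw [spProjMatrix_of_mem (mem_spSubmodule.1 h), AlgEquiv.apply_symm_apply]

theorem spProj_coe (X : SpLie n) : spProj n (X : SpOp n) = X :=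
  Subtype.ext (spProj_of_mem X.2)

theorem contDiffAt_cayley {k : ℕ∞ω} {A : SpOp n} (h : IsUnit (1 + A)) :
    ContDiffAt ℝ k cayley A := by
  refine (contDiffAt_const.sub contDiffAt_id).mul ?_
  obtain ⟨u, hu⟩ := h
  refine ContDiffAt.comp (g := Ring.inverse) (f := fun A : SpOp n => 1 + A) A ?_
    (contDiffAt_const.add contDiffAt_id)
  rw [← hu]
  exact contDiffAt_ringInverse ℝ u

theorem isUnit_one_add_of_mem_ball {X : SpLie n} (hX : X ∈ Metric.ball (0 : SpLie n) 1) :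
    IsUnit (1 + (X : SpOp n)) := by
  replace hX : ‖(X : SpOp n)‖ < 1 := mem_ball_zero_iff.1 hX
  have := isUnit_one_sub_of_norm_lt_one (x := -(X : SpOp n)) (by rw [norm_neg]; exact hX)
  rwa [sub_neg_eq_add] at this

theorem continuous_toOp_coe : Continuous fun A : Sp n => toOp n A.1 :=
  (continuous_toOp n).comp continuous_subtype_val

theorem isOpen_isUnit_one_add : IsOpen {A : Sp n | IsUnit (1 + toOp n A.1)} :=
  Units.isOpen.preimage (f := fun A : Sp n => 1 + toOp n A.1)
    (continuous_const.add continuous_toOp_coe)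

theorem continuousOn_spProj_cayley :
    ContinuousOn (fun A : Sp n => spProj n (cayley (toOp n A.1)))
      {A : Sp n | IsUnit (1 + toOp n A.1)} := by
  intro A hA
  refine ((spProj n).continuous.continuousAt.comp ?_).continuousWithinAt
  exact ContinuousAt.comp (g := cayley) (f := fun A : Sp n => toOp n A.1)
    (contDiffAt_cayley (k := 0) hA).continuousAt continuous_toOp_coe.continuousAt

theorem coe_spProj_cayley {A : Sp n} (h : IsUnit (1 + toOp n A.1)) :
    (spProj n (cayley (toOp n A.1)) : SpOp n) = cayley (toOp n A.1) := by
  have h' := isUnit_one_add_toOp.1 h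
  refine spProj_of_mem ?_
  rw [cayley_toOp h', mem_spSubmodule, AlgEquiv.symm_apply_apply]
  exact cayley_mem_sp A.2 h'

open Classical in
/-- The Cayley chart of the symplectic group, centred at the identity. -/
noncomputable def cayleyChart (n : ℕ) : OpenPartialHomeomorph (Sp n) (SpLie n) where
  toFun A := spProj n (cayley (toOp n A.1))
  invFun X := if h : IsUnit (1 + SpLie.incl n X) then
    ⟨cayley ((toOp n).symm (SpLie.incl n X)),
      cayley_mem_symplecticGroup X.2 (isUnit_one_add_symm.2 h)⟩ else 1
  source := {A : Sp n | IsUnit (1 + toOp n A.1)} ∩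
    (fun A : Sp n => spProj n (cayley (toOp n A.1))) ⁻¹' Metric.ball 0 1
  target := Metric.ball 0 1
  map_source' A hA := hA.2
  map_target' X hX := by
    have h := isUnit_one_add_of_mem_ball hX
    rw [dif_pos h]
    refine ⟨?_, ?_⟩
    · change IsUnit (1 + toOp n (cayley ((toOp n).symm (SpLie.incl n X))))
      rw [toOp_cayley_symm h]
      exact isUnit_one_add_cayley h
    · change spProj n (cayley (toOp n (cayley ((toOp n).symm (SpLie.incl n X))))) ∈ Metric.ball (0 : SpLie n) 1
      rwa [toOp_cayley_symm h, cayley_cayley h, spProj_coe]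
  left_inv' A hA := by
    have h0 := coe_spProj_cayley hA.1
    have h : IsUnit (1 + (spProj n (cayley (toOp n A.1)) : SpOp n)) := by
      rw [h0]; exact isUnit_one_add_cayley hA.1
    rw [dif_pos h]
    ext1
    apply (toOp n).injective
    change toOp n (cayley ((toOp n).symm (spProj n (cayley (toOp n A.1)) : SpOp n))) = toOp n A.1
    rw [toOp_cayley_symm h, h0, cayley_cayley hA.1]
  right_inv' X hX := by
    have h := isUnit_one_add_of_mem_ball hX
    rw [dif_pos h]
    change spProj n (cayley (toOp n (cayley ((toOp n).symm (SpLie.incl n X))))) = X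
    rw [toOp_cayley_symm h, cayley_cayley h, spProj_coe]
  open_source := continuousOn_spProj_cayley.isOpen_inter_preimage isOpen_isUnit_one_add
    Metric.isOpen_ball
  open_target := Metric.isOpen_ball
  continuousOn_toFun := continuousOn_spProj_cayley.mono fun A hA => hA.1
  continuousOn_invFun := by
    rw [continuousOn_iff_continuous_domRestrict]
    refine continuous_induced_rng.2 (continuous_iff_continuousAt.2 fun X => ?_)
    have h := isUnit_one_add_of_mem_ball X.2
    have h1 : ContinuousAt (fun X : Metric.ball (0 : SpLie n) 1 => cayley (SpLie.incl n X)) X :=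
      ContinuousAt.comp (g := cayley)
        (f := fun X : Metric.ball (0 : SpLie n) 1 => SpLie.incl n X)
        (contDiffAt_cayley (k := 0) h).continuousAt
        ((SpLie.incl n).continuous.comp continuous_subtype_val).continuousAt
    have h2 := (continuous_toOp_symm n).continuousAt.comp h1
    refine h2.congr (Filter.Eventually.of_forall fun Y => ?_)
    have hY := isUnit_one_add_of_mem_ball Y.2
    simp only [Function.comp_apply, Set.domRestrict_apply]
    rw [dif_pos hY, ← toOp_cayley_symm hY, AlgEquiv.symm_apply_apply]

theorem toOp_cayleyChart_symm {X : SpLie n} (hX : X ∈ Metric.ball (0 : SpLie n) 1) :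
    toOp n ((cayleyChart n).symm X).1 = cayley (SpLie.incl n X) := by
  have h := isUnit_one_add_of_mem_ball hX
  have h1 : (cayleyChart n).symm X = ⟨cayley ((toOp n).symm (SpLie.incl n X)),
      cayley_mem_symplecticGroup X.2 (isUnit_one_add_symm.2 h)⟩ := dif_pos h
  rw [h1, ← toOp_cayley_symm h]

theorem cayleyChart_symm_zero : (cayleyChart n).symm 0 = 1 := by
  refine Subtype.ext ((toOp n).injective ?_)
  rw [toOp_cayleyChart_symm (Metric.mem_ball_self one_pos)]
  refine Eq.trans ?_ (map_one (toOp n)).symm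
  exact cayley_zero

/-- The universal covering group of the real symplectic group `Sp(n, ℝ)`. -/
abbrev SpCover (n : ℕ) : Type := UniversalCover (Sp n)

namespace SpCover

/-- The covering homomorphism, with values in the space of operators. -/
noncomputable def projOp (x : SpCover n) : SpOp n := toOp n (UniversalCover.proj (Sp n) x).1

theorem projOp_mul (x y : SpCover n) : projOp (x * y) = projOp x * projOp y := by
  simp [projOp]

theorem projOp_inv (x : SpCover n) : projOp x⁻¹ =
    toOp n (-J (Fin n) ℝ * ((toOp n).symm (projOp x))ᵀ * J (Fin n) ℝ) := by
  simp [projOp, SymplecticGroup.coe_inv]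

/-- The chart centred at `a`: left translation by `a⁻¹`, followed by the lift to the universal
covering group of the Cayley chart. -/
noncomputable def chart (a : SpCover n) : OpenPartialHomeomorph (SpCover n) (SpLie n) :=
  (Homeomorph.mulLeft a⁻¹).transOpenPartialHomeomorph
    (UniversalCover.liftChart (cayleyChart n) (r := 1) rfl cayleyChart_symm_zero)

theorem chart_apply (a x : SpCover n) :
    chart a x = spProj n (cayley (projOp a⁻¹ * projOp x)) := by
  rw [← projOp_mul]; rfl

theorem mem_chart_source (a : SpCover n) : a ∈ (chart a).source := by
  change a⁻¹ * a ∈ (UniversalCover.liftChart (cayleyChart n) (r := 1) rfl cayleyChart_symm_zero).source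
  rw [inv_mul_cancel]
  refine ⟨1, fun t => ?_, map_one _⟩
  change (1 : Sp n) ∈ (cayleyChart n).source
  rw [← cayleyChart_symm_zero]
  exact (cayleyChart n).map_target (Metric.mem_ball_self one_pos)

theorem isUnit_of_mem_chart_source {a x : SpCover n} (h : x ∈ (chart a).source) :
    IsUnit (1 + projOp a⁻¹ * projOp x) := by
  rw [← projOp_mul]
  obtain ⟨γ, hγ, hx⟩ : a⁻¹ * x ∈ (UniversalCover.liftChart (cayleyChart n) (r := 1) rfl cayleyChart_symm_zero).source := h
  rw [← hx]
  exact (hγ 1).1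

theorem projOp_chart_symm (a : SpCover n) {X : SpLie n} (hX : X ∈ (chart a).target) :
    projOp ((chart a).symm X) = projOp a * cayley (X : SpOp n) := by
  have hX' : X ∈ Metric.ball (0 : SpLie n) 1 := hX
  have h1 := (chart a).map_target hX
  have h2 := (chart a).right_inv hX
  rw [chart_apply, ← projOp_mul] at h2
  have hu := isUnit_of_mem_chart_source h1
  rw [← projOp_mul] at hu
  have h3 := coe_spProj_cayley (A := UniversalCover.proj (Sp n) (a⁻¹ * (chart a).symm X)) hu
  have h4 : cayley (projOp (a⁻¹ * (chart a).symm X)) = (X : SpOp n) := by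
    exact h3.symm.trans (congrArg Subtype.val h2)
  rw [← h4, cayley_cayley hu, ← projOp_mul, mul_inv_cancel_left]

noncomputable instance : ChartedSpace (SpLie n) (SpCover n) where
  atlas := Set.range chart
  chartAt := chart
  mem_chart_source := mem_chart_source
  chart_mem_atlas := Set.mem_range_self

instance {k : ℕ∞ω} : IsManifold 𝓘(ℝ, SpLie n) k (SpCover n) := by
  refine isManifold_of_contDiffOn _ _ _ ?_
  rintro _ _ ⟨a, rfl⟩ ⟨b, rfl⟩ X hX
  have hX' : X ∈ ((chart a).symm ≫ₕ chart b).source := hX.1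
  rw [OpenPartialHomeomorph.trans_source] at hX'
  have hXa : X ∈ (chart a).target := hX'.1
  have hu : IsUnit (1 + projOp b⁻¹ * projOp ((chart a).symm X)) := isUnit_of_mem_chart_source hX'.2
  rw [projOp_chart_symm a hXa] at hu
  have key : ContDiffAt ℝ k (fun X : SpLie n =>
      spProj n (cayley (projOp b⁻¹ * (projOp a * cayley (X : SpOp n))))) X := by
    refine (spProj n).contDiff.contDiffAt.comp X ?_
    refine ContDiffAt.comp (g := cayley) X (contDiffAt_cayley hu) ?_
    refine contDiffAt_const.mul (contDiffAt_const.mul ?_)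
    exact ContDiffAt.comp (g := cayley) (f := SpLie.incl n) X
      (contDiffAt_cayley (isUnit_one_add_of_mem_ball hXa)) (SpLie.incl n).contDiff.contDiffAt
  refine key.contDiffWithinAt.congr (fun Y hY => ?_) ?_
  · change chart b ((chart a).symm Y) = _
    have hY' : Y ∈ ((chart a).symm ≫ₕ chart b).source := hY.1
    rw [OpenPartialHomeomorph.trans_source] at hY'
    rw [chart_apply, projOp_chart_symm a hY'.1]
  · change chart b ((chart a).symm X) = _
    rw [chart_apply, projOp_chart_symm a hXa]

theorem contMDiff_projOp {k : ℕ∞ω} :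
    ContMDiff 𝓘(ℝ, SpLie n) 𝓘(ℝ, SpOp n) k (projOp (n := n)) := by
  intro x
  have h0 : ContMDiffAt 𝓘(ℝ, SpLie n) 𝓘(ℝ, SpLie n) k (chart x) x :=
    (contMDiffOn_chart (I := 𝓘(ℝ, SpLie n)) (x := x)).contMDiffAt
      ((chart x).open_source.mem_nhds (mem_chart_source x))
  have h1 : ContDiffAt ℝ k (fun X : SpLie n => projOp x * cayley (X : SpOp n)) (chart x x) := by
    refine contDiffAt_const.mul ?_
    exact ContDiffAt.comp (g := cayley) (f := SpLie.incl n) _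
      (contDiffAt_cayley (isUnit_one_add_of_mem_ball ((chart x).map_source (mem_chart_source x))))
      (SpLie.incl n).contDiff.contDiffAt
  refine (ContMDiffAt.comp x h1.contMDiffAt h0).congr_of_eventuallyEq ?_
  filter_upwards [(chart x).open_source.mem_nhds (mem_chart_source x)] with y hy
  have := projOp_chart_symm x ((chart x).map_source hy)
  rw [(chart x).left_inv hy] at this
  exact this

/-- A continuous map into the universal covering group is smooth if the corresponding map into the
space of matrices is smooth. -/
theorem contMDiff_of_projOp {k : ℕ∞ω} {E H M : Type*} [NormedAddCommGroup E] [NormedSpace ℝ E]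
    [TopologicalSpace H] {I : ModelWithCorners ℝ E H} [TopologicalSpace M] [ChartedSpace H M]
    {f : M → SpCover n} (hc : Continuous f)
    (hf : ContMDiff I 𝓘(ℝ, SpOp n) k (fun x => projOp (f x))) :
    ContMDiff I 𝓘(ℝ, SpLie n) k f := by
  intro x
  rw [contMDiffAt_iff_target]
  refine ⟨hc.continuousAt, ?_⟩
  have hu : IsUnit (1 + projOp (f x)⁻¹ * projOp (f x)) :=
    isUnit_of_mem_chart_source (mem_chart_source (f x))
  have h1 : ContDiffAt ℝ k (fun A : SpOp n => spProj n (cayley (projOp (f x)⁻¹ * A)))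
      (projOp (f x)) := by
    refine (spProj n).contDiff.contDiffAt.comp _ ?_
    exact ContDiffAt.comp (g := cayley) _ (contDiffAt_cayley hu)
      (contDiffAt_const.mul contDiffAt_id)
  refine (ContMDiffAt.comp x h1.contMDiffAt (hf x)).congr_of_eventuallyEq ?_
  exact Filter.Eventually.of_forall fun y => chart_apply (f x) (f y)

/-- The universal covering group of the real symplectic group is a Lie group. -/
instance {k : ℕ∞ω} : LieGroup 𝓘(ℝ, SpLie n) k (SpCover n) where
  contMDiff_mul := by
    refine contMDiff_of_projOp (f := fun p : SpCover n × SpCover n => p.1 * p.2) continuous_mul ?_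
    simp only [projOp_mul]
    have h : ContMDiff 𝓘(ℝ, SpOp n × SpOp n) 𝓘(ℝ, SpOp n) k (fun p : SpOp n × SpOp n => p.1 * p.2) :=
      contDiff_mul.contMDiff
    have h1 : ContMDiff (𝓘(ℝ, SpLie n).prod 𝓘(ℝ, SpLie n)) 𝓘(ℝ, SpOp n) k
        (fun p : SpCover n × SpCover n => projOp p.1) := contMDiff_projOp.comp contMDiff_fst
    have h2 : ContMDiff (𝓘(ℝ, SpLie n).prod 𝓘(ℝ, SpLie n)) 𝓘(ℝ, SpOp n) k
        (fun p : SpCover n × SpCover n => projOp p.2) := contMDiff_projOp.comp contMDiff_snd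
    exact h.comp (h1.prodMk_space h2)
  contMDiff_inv := by
    refine contMDiff_of_projOp continuous_inv ?_
    simp only [projOp_inv]
    have h : ContDiff ℝ k (fun A : SpOp n =>
        toOp n (-J (Fin n) ℝ * ((toOp n).symm A)ᵀ * J (Fin n) ℝ)) := by
      simp only [map_mul]
      refine (contDiff_const.mul ?_).mul contDiff_const
      exact (LinearMap.toContinuousLinearMap ((toOp n).toLinearMap ∘ₗ
        (Matrix.transposeLinearEquiv (Fin n ⊕ Fin n) (Fin n ⊕ Fin n) ℝ ℝ).toLinearMap ∘ₗ
        (toOp n).symm.toLinearMap)).contDiff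
    exact h.contMDiff.comp contMDiff_projOp

end SpCover

end Symplectic

/-! Let `z` centralize the image of `ρ`, and let `A` be its projection to the symplectic group. The
differential of `ρ` at the identity is an injective homomorphism `ψ : 𝔰𝔭(n) × 𝔰𝔭(1) → 𝔰𝔭(n+1)`, and
`A` commutes with its image. The heart of the proof is that `A² = 1` (`symplectic_sq_eq_one`).

Otherwise `B = A - A⁻¹` is a nonzero element of `𝔰𝔭(n+1)` that commutes with the image of `ψ`. Over
`ℂ`, an eigenspace of `B` for a nonzero eigenvalue or, if `B` is nilpotent, the range of its last
nonzero power is a nonzero isotropic subspace `W`, invariant under the complexified image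
(`exists_isotropic_of_skew`). The stabilizer of `W` is a parabolic subalgebra. The source has no
nonzero `x` with `(ad x)² = 0`, so it meets the nilradical trivially and embeds linearly into the
Levi part `𝔤𝔩(W) × 𝔰𝔭(Wᗮ/W)` (`finrank_le_of_isotropic_invariant`). With `d = dim W ≥ 1` and `s = n
+ 1 - d` this gives `n(2n+1) + 3 ≤ d² + s(2s+1)`, which is false.

So the centralizer projects onto a group of involutory matrices. These commute and are
simultaneously diagonalizable with eigenvalues `±1`, hence finite in number
(`finite_of_mul_self_eq_one`). The kernel of the covering homomorphism is central
(`ker_proj_le_center`), so the center has finite index. -/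

/-! ### Invariant isotropic subspaces of a symplectic space -/

section IsotropicStabilizer

open Module

/-- A Lie algebra `𝔤` without nonzero elements whose adjoint operator squares to zero that acts
faithfully on a symplectic space and leaves an isotropic subspace `W` invariant embeds into
`End W × Sym² (Wᗮ / W)`. -/
theorem finrank_le_of_isotropic_invariant {k V 𝔤 : Type*} [Field k] [AddCommGroup V] [Module k V]
    [LieRing 𝔤] [LieAlgebra k 𝔤] [FiniteDimensional k V]
    (ψ : 𝔤 →ₗ[k] End k V)
    (hψ : Function.Injective ψ) (hbr : ∀ x y, ψ ⁅x, y⁆ = ψ x * ψ y - ψ y * ψ x)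
    (hsand : ∀ x : 𝔤, (∀ y : 𝔤, ⁅x, ⁅x, y⁆⁆ = 0) → x = 0)
    (Ω : LinearMap.BilinForm k V) (hΩ : Ω.Nondegenerate) (hanti : ∀ x y, Ω x y = -Ω y x)
    (hskew : ∀ X x y, Ω (ψ X x) y = -Ω x (ψ X y))
    (W : Submodule k V) (hinv : ∀ X, ∀ w ∈ W, ψ X w ∈ W) (hiso : ∀ x ∈ W, ∀ y ∈ W, Ω x y = 0) :
    ∃ m, finrank k V = 2 * finrank k W + m ∧
      finrank k 𝔤 ≤ finrank k W ^ 2 + (m + 1).choose 2 := by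
  have hrefl : Ω.IsRefl := fun x y h => by rw [hanti, h, neg_zero]
  set P := Ω.orthogonal W with hP
  have hWP : W ≤ P := fun y hy => LinearMap.BilinForm.mem_orthogonal_iff.2 fun x hx => hiso x hx y hy
  have hPP : Ω.orthogonal P = W := LinearMap.BilinForm.orthogonal_orthogonal hΩ hrefl W
  have memW : ∀ x, (∀ p ∈ P, Ω p x = 0) → x ∈ W := fun x hx => by
    rw [← hPP]; exact LinearMap.BilinForm.mem_orthogonal_iff.2 hx
  have memP : ∀ x, (∀ p ∈ W, Ω p x = 0) → x ∈ P := fun x hx => LinearMap.BilinForm.mem_orthogonal_iff.2 hx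
  have ofP : ∀ w ∈ W, ∀ p ∈ P, Ω w p = 0 := fun w hw p hp => LinearMap.BilinForm.mem_orthogonal_iff.1 hp w hw
  have hinvP : ∀ X, ∀ p ∈ P, ψ X p ∈ P := fun X p hp => memP _ fun w hw => by
    rw [← neg_eq_zero, ← hskew]; exact ofP _ (hinv X w hw) p hp
  have hbr' : ∀ x y v, ψ ⁅x, y⁆ v = ψ x (ψ y v) - ψ y (ψ x v) := fun x y v => by rw [hbr]; rfl
  -- the kernel of the action on `W × Wᗮ / W` vanishes
  have hK2 : ∀ x, (∀ v, ψ x v ∈ W) → (∀ p ∈ P, ψ x p = 0) → x = 0 := by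
    -- Here `(ad x)² y = x²y - 2xyx + yx²`. Since `x V ⊆ W ⊆ P`, `x P = 0` and `y W ⊆ W`, every term
    -- vanishes.
    refine fun x h1 h2 => hsand x fun y => hψ (LinearMap.ext fun v => ?_)
    have h3 : ψ x (ψ y (ψ x v)) = 0 := h2 _ (hWP (hinv y _ (h1 v)))
    have h4 : ∀ u, ψ x (ψ x u) = 0 := fun u => h2 _ (hWP (h1 u))
    simp [hbr', h3, h4]
  have hK : ∀ x, (∀ w ∈ W, ψ x w = 0) → (∀ p ∈ P, ψ x p ∈ W) → x = 0 := by
    have hV : ∀ x, (∀ w ∈ W, ψ x w = 0) → ∀ v, ψ x v ∈ P := fun x h1 v => memP _ fun w hw => by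
      rw [← neg_eq_zero, ← hskew, h1 w hw]; simp
    -- By skewness `x` maps `V` into `P`, so it lowers the filtration `V ⊇ P ⊇ W ⊇ 0` by one step
    -- and `(ad x)² y` lowers it by two. The latter therefore satisfies the hypotheses of `hK2` and
    -- is zero.
    refine fun x h1 h2 => hsand x fun y => hK2 _ (fun v => ?_) fun p hp => ?_
    · have a1 : ψ x (ψ y (ψ x v)) ∈ W := h2 _ (hinvP y _ (hV x h1 v))
      have a2 : ∀ u, ψ x (ψ x u) ∈ W := fun u => h2 _ (hV x h1 u)
      simp only [hbr', map_sub]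
      exact W.sub_mem (W.sub_mem (a2 _) a1) (W.sub_mem a1 (hinv y _ (a2 _)))
    · have a1 : ψ x (ψ y (ψ x p)) = 0 := h1 _ (hinv y _ (h2 p hp))
      have a2 : ∀ u ∈ P, ψ x (ψ x u) = 0 := fun u hu => h1 _ (h2 u hu)
      simp [hbr', a1, a2 p hp, a2 _ (hinvP y p hp)]
  obtain ⟨U₀, hU₀⟩ := Submodule.exists_isCompl (W.submoduleOf P)
  have hU : ∀ p ∈ P, ∃ w ∈ W, ∃ u : U₀, p = w + (u : P) := fun p hp => by
    obtain ⟨w, hw, u, hu, h⟩ := Submodule.mem_sup.1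
      (hU₀.sup_eq_top ▸ Submodule.mem_top : (⟨p, hp⟩ : P) ∈ W.submoduleOf P ⊔ U₀)
    exact ⟨w, hw, ⟨u, hu⟩, (congrArg Subtype.val h).symm⟩
  have hdim : finrank k V = 2 * finrank k W + finrank k U₀ := by
    have h1 := Submodule.finrank_add_eq_of_isCompl hU₀
    rw [(Submodule.submoduleOfEquivOfLe hWP).finrank_eq, LinearMap.BilinForm.finrank_orthogonal hΩ] at h1
    have h2 := Submodule.finrank_le W
    omega
  refine ⟨finrank k U₀, hdim, ?_⟩
  let b := Module.finBasis k U₀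
  have hsymm : ∀ X x y, Ω (ψ X x) y = Ω (ψ X y) x := fun X x y => by rw [hskew, hanti, neg_neg]
  -- A complement `U₀` of `W` in `P` stands for `P / W`. The action of `X` there is recorded by the
  -- form `Ω (X u) v`, which is symmetric because `X` is skew for an alternating form; hence the
  -- count by unordered pairs.
  let Q : 𝔤 →ₗ[k] (Sym2 (Fin (finrank k U₀)) → k) :=
    { toFun := fun X => Sym2.lift ⟨fun i j => Ω (ψ X (b i : P)) (b j : P), fun i j => hsymm _ _ _⟩
      map_add' := fun X Y => by ext ⟨i, j⟩; simp
      map_smul' := fun c X => by ext ⟨i, j⟩; simp }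
  let R : 𝔤 →ₗ[k] (W →ₗ[k] W) :=
    { toFun := fun X => (ψ X).restrict (hinv X)
      map_add' := fun X Y => by ext; simp
      map_smul' := fun c X => by ext; simp }
  have hinj : Function.Injective (R.prod Q) := by
    rw [injective_iff_map_eq_zero]
    intro X hX
    obtain ⟨h1, h2⟩ := Prod.mk.inj hX
    have hW0 : ∀ w ∈ W, ψ X w = 0 := fun w hw =>
      congrArg Subtype.val (LinearMap.congr_fun h1 ⟨w, hw⟩)
    have hU0 : ∀ u v : U₀, Ω (ψ X (u : P)) (v : P) = 0 := by
      let q : LinearMap.BilinForm k U₀ := (Ω ∘ₗ ψ X).compl₁₂ (P.subtype ∘ₗ U₀.subtype)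
        (P.subtype ∘ₗ U₀.subtype)
      have : q = 0 := LinearMap.BilinForm.ext_basis b fun i j => congrFun h2 s(i, j)
      exact fun u v => LinearMap.congr_fun (LinearMap.congr_fun this u) v
    -- If both components vanish, then `Ω (X p) p' = 0` for all `p, p' ∈ P`, so `X P ⊆ Pᗮ = W` and
    -- `hK` applies.
    refine hK X hW0 fun p hp => memW _ fun p' hp' => ?_
    obtain ⟨w, hw, u, rfl⟩ := hU p hp
    obtain ⟨w', hw', u', rfl⟩ := hU p' hp'
    have e : ψ X (w + (u : P)) = ψ X (u : P) := by rw [map_add, hW0 w hw, zero_add]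
    rw [e, hanti, map_add, hU0, hsymm, hW0 w' hw']
    simp
  refine (LinearMap.finrank_le_finrank_of_injective hinj).trans_eq ?_
  rw [Module.finrank_prod, Module.finrank_linearMap, Module.finrank_fintype_fun_eq_card, Sym2.card,
    Fintype.card_fin, sq]

/-- A nonzero operator that is skew for a symplectic form leaves a nonzero isotropic subspace
invariant, and this subspace is invariant under everything that commutes with the operator. -/
theorem exists_isotropic_of_skew {k V : Type*} [Field k] [IsAlgClosed k] [CharZero k]
    [AddCommGroup V] [Module k V] [FiniteDimensional k V] (Ω : LinearMap.BilinForm k V) (B : End k V)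
    (hB : B ≠ 0) (hskew : ∀ x y, Ω (B x) y = -Ω x (B y)) :
    ∃ W : Submodule k V, W ≠ ⊥ ∧ (∀ x ∈ W, ∀ y ∈ W, Ω x y = 0) ∧
      ∀ X : End k V, Commute X B → ∀ w ∈ W, X w ∈ W := by
  by_cases h : ∃ c ≠ 0, B.HasEigenvalue c
  · obtain ⟨c, hc, hcB⟩ := h
    refine ⟨B.eigenspace c, End.hasEigenvalue_iff.1 hcB, fun x hx y hy => ?_, fun X hX w hw => ?_⟩
    · have h := hskew x y
      rw [End.mem_eigenspace_iff.1 hx, End.mem_eigenspace_iff.1 hy] at h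
      simp only [map_smul, LinearMap.smul_apply, smul_eq_mul] at h
      have h2 : (2 * c) * Ω x y = 0 := by linear_combination h
      exact (mul_eq_zero.1 h2).resolve_left (mul_ne_zero two_ne_zero hc)
    · rw [End.mem_eigenspace_iff] at hw ⊢
      have := LinearMap.congr_fun hX.eq w
      simp only [End.mul_apply] at this
      rw [← this, hw, map_smul]
  · push Not at h
    -- Without nonzero eigenvalues, the generalized eigenspace for `0` is the whole space.
    have hnil : IsNilpotent B := by
      have h0 : ∀ c ≠ 0, B.maxGenEigenspace c = ⊥ := fun c hc => by
        by_contra h1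
        refine h c hc ?_
        rw [End.maxGenEigenspace_eq] at h1
        exact End.hasEigenvalue_of_hasGenEigenvalue (End.hasGenEigenvalue_iff.2 h1)
      have h1 : B.maxGenEigenspace 0 = ⊤ := by
        rw [← End.iSup_maxGenEigenspace_eq_top B]
        refine le_antisymm (le_iSup _ _) (iSup_le fun c => ?_)
        by_cases hc : c = 0
        · rw [hc]
        · rw [h0 c hc]; exact bot_le
      rw [End.maxGenEigenspace_eq] at h1
      refine ⟨B.maxGenEigenspaceIndex 0, LinearMap.ext fun v => ?_⟩
      have := h1.ge (Submodule.mem_top (x := v))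
      rw [End.mem_genEigenspace_nat] at this
      simpa using this
    -- The last nonzero power has exponent `j + 1 ≥ 1` because `B ≠ 0`. This gives `2 (j + 1) ≥ j +
    -- 2`, which makes the range of `B ^ (j + 1)` isotropic.
    obtain ⟨j, hj, hj'⟩ : ∃ j, B ^ (j + 1) ≠ 0 ∧ B ^ (j + 2) = 0 := by
      classical
      have h0 : Nat.find hnil ≠ 0 := fun h0 => by
        have := Nat.find_spec hnil
        rw [h0, pow_zero] at this
        exact hB (by rw [← mul_one B, this, mul_zero])
      have h1 : Nat.find hnil ≠ 1 := fun h0 => by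
        have := Nat.find_spec hnil
        rw [h0, pow_one] at this
        exact hB this
      refine ⟨Nat.find hnil - 2, Nat.find_min hnil (by omega), ?_⟩
      rw [Nat.sub_add_cancel (by omega)]
      exact Nat.find_spec hnil
    have hpow : ∀ i x y, Ω ((B ^ i) x) y = (-1) ^ i * Ω x ((B ^ i) y) := fun i => by
      induction i with
      | zero => simp
      | succ i ih => 
        intro x y
        have e1 : (B ^ (i + 1)) x = (B ^ i) (B x) := by rw [pow_succ]; rfl
        have e2 : (B ^ (i + 1)) y = B ((B ^ i) y) := by rw [pow_succ']; rfl
        rw [e1, e2, ih, hskew]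
        ring
    refine ⟨(B ^ (j + 1)).range, fun h => hj (LinearMap.range_eq_bot.1 h), ?_, ?_⟩
    · rintro _ ⟨x, rfl⟩ _ ⟨y, rfl⟩
      have e : (B ^ (j + 1)) ((B ^ (j + 1)) y) = 0 := by
        rw [← End.mul_apply, ← pow_add, show j + 1 + (j + 1) = j + 2 + j by ring, pow_add B, hj',
          zero_mul, LinearMap.zero_apply]
      rw [hpow, e, map_zero, mul_zero]
    · rintro X hX _ ⟨x, rfl⟩
      exact ⟨X x, by rw [← End.mul_apply, ← (hX.pow_right (j + 1)).eq]; rfl⟩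

end IsotropicStabilizer

/-! ### The symplectic Lie algebra over a field -/

section SymplecticLieAlgebra

open Matrix LieAlgebra.Symplectic

variable {l : Type*} [Fintype l] [DecidableEq l]

theorem mem_sp_iff_transpose_mul_J {R : Type*} [CommRing R] {X : Matrix (l ⊕ l) (l ⊕ l) R} :
    X ∈ sp l R ↔ Xᵀ * J l R = -(J l R * X) := by
  rw [sp, mem_skewAdjointMatricesLieSubalgebra, mem_skewAdjointMatricesSubmodule,
    Matrix.IsSkewAdjoint, Matrix.IsAdjointPair, mul_neg]

/-- The rank one elements of the symplectic Lie algebra. -/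
theorem vecMulVec_mem_sp {R : Type*} [CommRing R] (v : l ⊕ l → R) :
    vecMulVec v (v ᵥ* J l R) ∈ sp l R := by
  rw [mem_sp_iff_transpose_mul_J, transpose_vecMulVec, vecMulVec_mul, mul_vecMulVec]
  have h : v ᵥ* J l R = -(J l R *ᵥ v) := by
    rw [← neg_mulVec, ← J_transpose, mulVec_transpose]
  rw [← vecMulVec_neg, h, neg_neg, neg_vecMulVec, ← vecMulVec_neg, neg_neg]

/-- Test against the rank one elements `y = b(v, ·) v`. Since `b(v, v) = 0` and `b(v, M²v) = -b(Mv,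
Mv) = 0`, evaluating `(ad M)² y` at `v` leaves `-2 b(v, Mv) Mv`, so `b(v, Mv) = 0` for every `v`.
The form `b(u, Mv)` is symmetric, and polarization kills it. -/
theorem sp_eq_zero_of_ad_sq_eq_zero {K : Type*} [Field K] [CharZero K] (x : sp l K)
    (h : ∀ y : sp l K, ⁅x, ⁅x, y⁆⁆ = 0) : x = 0 := by
  set M := x.1 with hM
  have hx := mem_sp_iff_transpose_mul_J.1 x.2
  let b : (l ⊕ l → K) → (l ⊕ l → K) → K := fun u v => u ⬝ᵥ J l K *ᵥ v
  have hanti : ∀ u v, b u v = - b v u := fun u v => by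
    simp only [b]
    rw [dotProduct_mulVec, ← mulVec_transpose, J_transpose, neg_mulVec, neg_dotProduct,
      dotProduct_comm]
  have hskew : ∀ u v, b (M *ᵥ u) v = - b u (M *ᵥ v) := fun u v => by
    simp only [b]
    rw [mulVec_mulVec, ← dotProduct_neg, ← neg_mulVec, ← hx, ← mulVec_mulVec, dotProduct_mulVec u,
      vecMul_transpose]
  have hself : ∀ u, b u u = 0 := fun u => self_eq_neg.1 (hanti u u)
  have key : ∀ v, b v (M *ᵥ v) = 0 := fun v => by
    have h1 : ⁅M, ⁅M, vecMulVec v (v ᵥ* J l K)⁆⁆ = 0 :=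
      congrArg Subtype.val (h ⟨_, vecMulVec_mem_sp v⟩)
    have hy : ∀ u, vecMulVec v (v ᵥ* J l K) *ᵥ u = b v u • v := fun u => by
      ext i
      simp only [b, vecMulVec_mulVec, dotProduct_mulVec, Pi.smul_apply, smul_eq_mul]
      simp [mul_comm]
    have h2 : b v (M *ᵥ (M *ᵥ v)) = 0 := by
      rw [← neg_eq_zero, ← hskew, hself]
    have h3 := congrArg (· *ᵥ v) h1
    simp only [Ring.lie_def, mul_sub, sub_mul, sub_mulVec, ← mulVec_mulVec, hy, mulVec_smul,
      hself, h2, zero_smul, zero_mulVec, zero_sub, sub_zero, mulVec_zero] at h3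
    have h4 : (2 * b v (M *ᵥ v)) • (M *ᵥ v) = 0 := by
      rw [← neg_eq_zero, ← h3, two_mul, add_smul, neg_add']
    rcases smul_eq_zero.1 h4 with h5 | h5
    · exact (mul_eq_zero.1 h5).resolve_left two_ne_zero
    · rw [h5]; simp [b]
  have hpol : ∀ u v, b u (M *ᵥ v) = 0 := fun u v => by
    have h1 := key (u + v)
    have h2 : b (u + v) (M *ᵥ (u + v)) =
        b u (M *ᵥ u) + b u (M *ᵥ v) + (b v (M *ᵥ u) + b v (M *ᵥ v)) := by
      simp only [b, mulVec_add, dotProduct_add, add_dotProduct]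
    have h3 : b v (M *ᵥ u) = b u (M *ᵥ v) := by rw [hanti, hskew, neg_neg]
    rw [h2, key, key, h3, zero_add, add_zero, ← two_mul] at h1
    exact (mul_eq_zero.1 h1).resolve_left two_ne_zero
  have hJ : J l K * M = 0 := by
    ext i j
    have := hpol (Pi.single i 1) (Pi.single j 1)
    simp only [b, mulVec_mulVec] at this
    simpa using this
  refine Subtype.ext ?_
  have h1 := congrArg (J l K * ·) hJ
  rw [← mul_assoc, J_squared, mul_zero, neg_mul, one_mul, neg_eq_zero] at h1
  exact h1

/-- A symmetric matrix, given by a function on unordered pairs, multiplied by `J`. -/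
def spOfSym2 (l K : Type*) [Fintype l] [DecidableEq l] [Field K] :
    (Sym2 (l ⊕ l) → K) →ₗ[K] sp l K where
  toFun f := ⟨J l K * of fun i j => f s(i, j), by
    have h : (of fun i j => f s(i, j))ᵀ = of fun i j => f s(i, j) := by
      ext i j; simp [Sym2.eq_swap]
    rw [mem_sp_iff_transpose_mul_J, transpose_mul, h, J_transpose, mul_assoc, neg_mul,
      ← mul_assoc (J l K), J_squared]
    simp⟩
  map_add' f g := by
    refine Subtype.ext ?_
    change _ = _ + _
    rw [← mul_add]
    rfl
  map_smul' c f := by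
    refine Subtype.ext ?_
    change _ = c • _
    rw [← mul_smul_comm]
    rfl

/-- Multiplication by `J` embeds the symmetric matrices, and these have one free entry for each
unordered pair of the `2m` indices. The dimension count needs only this bound. -/
theorem le_finrank_sp (m : ℕ) (K : Type*) [Field K] :
    (2 * m + 1).choose 2 ≤ Module.finrank K (sp (Fin m) K) := by
  have h : Function.Injective (spOfSym2 (Fin m) K) := by
    rw [injective_iff_map_eq_zero]
    intro f hf
    have h1 := congrArg (fun X : sp (Fin m) K => J (Fin m) K * X.1) hf
    have h2 : of (fun i j => f s(i, j)) = 0 := by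
      have h3 : J (Fin m) K * (J (Fin m) K * of fun i j => f s(i, j)) = 0 := by
        refine h1.trans ?_
        simp
      rwa [← mul_assoc, J_squared, neg_mul, one_mul, neg_eq_zero] at h3
    ext ⟨i, j⟩
    exact congrFun (congrFun h2 i) j
  have := LinearMap.finrank_le_finrank_of_injective h
  rw [Module.finrank_fintype_fun_eq_card, Sym2.card, Fintype.card_sum, Fintype.card_fin] at this
  rwa [two_mul]

/-- `-J Aᵀ J` is the adjoint of `A` for the form `J`, so the difference is skew-adjoint. For
symplectic `A` this adjoint is `A⁻¹`. -/
theorem sub_symplectic_inv_mem_sp {R : Type*} [CommRing R] {A : Matrix (l ⊕ l) (l ⊕ l) R}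
    (A' : Matrix (l ⊕ l) (l ⊕ l) R) (hA' : A' = -J l R * Aᵀ * J l R) : A - A' ∈ sp l R := by
  have hJ := J_squared l R
  have h1 : J l R * A' = Aᵀ * J l R := by
    rw [hA', ← mul_assoc, ← mul_assoc, mul_neg, hJ]; simp
  have h2 : A'ᵀ * J l R = J l R * A := by
    rw [hA', transpose_mul, transpose_mul, transpose_neg, J_transpose, transpose_transpose]
    simp [mul_assoc, hJ]
  rw [mem_sp_iff_transpose_mul_J, transpose_sub, sub_mul, h2, mul_sub, h1]
  abel

end SymplecticLieAlgebra

/-! ### Complexification and the dimension count -/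

section Complexification

open Matrix LieAlgebra.Symplectic

variable {l m : Type*} [Fintype l] [DecidableEq l] [Fintype m] [DecidableEq m]

/-- A real functional on `ℂ`, applied to the entries of a complex element of the symplectic Lie
algebra. -/
noncomputable def spMap (l : Type*) [Fintype l] [DecidableEq l] (f : ℂ →ₗ[ℝ] ℝ) : sp l ℂ →ₗ[ℝ] sp l ℝ where
  toFun X := ⟨X.1.map f, by
    have h := mem_sp_iff_transpose_mul_J.1 X.2
    have e : ∀ i j, J l ℂ i j = (J l ℝ i j : ℂ) := fun i j => by
      rw [← map_J l Complex.ofRealHom]; rfl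
    have hf : ∀ (z : ℂ) (r : ℝ), f (z * r) = f z * r := fun z r => by
      rw [mul_comm, ← Complex.real_smul, map_smul, smul_eq_mul, mul_comm]
    have hf' : ∀ (z : ℂ) (r : ℝ), f (r * z) = r * f z := fun z r => by
      rw [← Complex.real_smul, map_smul, smul_eq_mul]
    rw [mem_sp_iff_transpose_mul_J]
    ext i j
    have := congrArg f (congrFun (congrFun h i) j)
    simpa only [mul_apply, Matrix.neg_apply, transpose_apply, map_apply, map_sum, map_neg, e, hf, hf']
      using this⟩
  map_add' X Y := Subtype.ext (by ext; simp)
  map_smul' c X := Subtype.ext (by ext i j; exact map_smul f c (X.1 i j))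

/-- A real functional on `ℂ`, applied to the entries of a pair. -/
noncomputable def spMapProd (l m : Type*) [Fintype l] [DecidableEq l] [Fintype m] [DecidableEq m]
    (f : ℂ →ₗ[ℝ] ℝ) : (sp l ℂ × sp m ℂ) →ₗ[ℝ] sp l ℝ × sp m ℝ :=
  (spMap l f).prodMap (spMap m f)

local notation "re" => spMapProd l m Complex.reLm
local notation "im" => spMapProd l m Complex.imLm

/-- This and the next three lemmas express the decomposition `x = re x + i im x`, by which `sp l ℂ`
serves as the complexification of `sp l ℝ`. -/
theorem spMap_re_smul (c : ℂ) (x : sp l ℂ) : spMap l Complex.reLm (c • x) =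
    c.re • spMap l Complex.reLm x - c.im • spMap l Complex.imLm x :=
  Subtype.ext (by ext; simp [spMap])

theorem spMap_im_smul (c : ℂ) (x : sp l ℂ) : spMap l Complex.imLm (c • x) =
    c.re • spMap l Complex.imLm x + c.im • spMap l Complex.reLm x :=
  Subtype.ext (by ext; simp [spMap])

theorem spMap_re_lie (x y : sp l ℂ) : spMap l Complex.reLm ⁅x, y⁆ =
    ⁅spMap l Complex.reLm x, spMap l Complex.reLm y⁆ -
      ⁅spMap l Complex.imLm x, spMap l Complex.imLm y⁆ :=
  Subtype.ext (by
    ext i j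
    simp [spMap, Ring.lie_def, mul_apply, Finset.sum_sub_distrib]
    ring)

theorem spMap_im_lie (x y : sp l ℂ) : spMap l Complex.imLm ⁅x, y⁆ =
    ⁅spMap l Complex.reLm x, spMap l Complex.imLm y⁆ +
      ⁅spMap l Complex.imLm x, spMap l Complex.reLm y⁆ :=
  Subtype.ext (by
    ext i j
    simp [spMap, Ring.lie_def, mul_apply, Finset.sum_add_distrib]
    ring)

theorem spMap_re_im_injective {x : sp l ℂ} (h1 : spMap l Complex.reLm x = 0)
    (h2 : spMap l Complex.imLm x = 0) : x = 0 :=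
  Subtype.ext (by
    ext i j
    have h3 := congrFun (congrFun (congrArg Subtype.val h1) i) j
    have h4 := congrFun (congrFun (congrArg Subtype.val h2) i) j
    exact Complex.ext h3 h4)

theorem re_smul (c : ℂ) (x : sp l ℂ × sp m ℂ) : re (c • x) = c.re • re x - c.im • im x :=
  Prod.ext (spMap_re_smul c x.1) (spMap_re_smul c x.2)

theorem im_smul (c : ℂ) (x : sp l ℂ × sp m ℂ) : im (c • x) = c.re • im x + c.im • re x :=
  Prod.ext (spMap_im_smul c x.1) (spMap_im_smul c x.2)

theorem re_lie (x y : sp l ℂ × sp m ℂ) : re ⁅x, y⁆ = ⁅re x, re y⁆ - ⁅im x, im y⁆ :=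
  Prod.ext (spMap_re_lie x.1 y.1) (spMap_re_lie x.2 y.2)

theorem im_lie (x y : sp l ℂ × sp m ℂ) : im ⁅x, y⁆ = ⁅re x, im y⁆ + ⁅im x, re y⁆ :=
  Prod.ext (spMap_im_lie x.1 y.1) (spMap_im_lie x.2 y.2)

theorem toC_mul {p : Type*} [Fintype p] (X Y : Matrix p p ℝ) :
    (X * Y).map Complex.ofReal = X.map Complex.ofReal * Y.map Complex.ofReal :=
  Matrix.map_mul (f := Complex.ofRealHom)

variable {p : Type*} [Fintype p] [DecidableEq p]

/-- The complexification of a representation of the product of two symplectic Lie algebras. -/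
noncomputable def complexify (ψ : sp l ℝ × sp m ℝ →ₗ⁅ℝ⁆ sp p ℝ) :
    (sp l ℂ × sp m ℂ) →ₗ[ℂ] Matrix (p ⊕ p) (p ⊕ p) ℂ where
  toFun x := (ψ (re x)).1.map Complex.ofReal + Complex.I • (ψ (im x)).1.map Complex.ofReal
  map_add' x y := by
    ext i j
    simp
    ring
  map_smul' c x := by
    ext i j
    rw [re_smul, im_smul]
    apply Complex.ext <;> simp

theorem complexify_lie (ψ : sp l ℝ × sp m ℝ →ₗ⁅ℝ⁆ sp p ℝ) (x y : sp l ℂ × sp m ℂ) :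
    complexify ψ ⁅x, y⁆ = complexify ψ x * complexify ψ y - complexify ψ y * complexify ψ x := by
  have h1 : (ψ (re ⁅x, y⁆)).1 = ⁅(ψ (re x)).1, (ψ (re y)).1⁆ - ⁅(ψ (im x)).1, (ψ (im y)).1⁆ := by
    rw [re_lie, map_sub, LieHom.map_lie, LieHom.map_lie]; rfl
  have h2 : (ψ (im ⁅x, y⁆)).1 = ⁅(ψ (re x)).1, (ψ (im y)).1⁆ + ⁅(ψ (im x)).1, (ψ (re y)).1⁆ := by
    rw [im_lie, map_add, LieHom.map_lie, LieHom.map_lie]; rfl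
  change (ψ (re ⁅x, y⁆)).1.map Complex.ofReal + Complex.I • (ψ (im ⁅x, y⁆)).1.map Complex.ofReal =
    ((ψ (re x)).1.map Complex.ofReal + Complex.I • (ψ (im x)).1.map Complex.ofReal) *
      ((ψ (re y)).1.map Complex.ofReal + Complex.I • (ψ (im y)).1.map Complex.ofReal) -
    ((ψ (re y)).1.map Complex.ofReal + Complex.I • (ψ (im y)).1.map Complex.ofReal) *
      ((ψ (re x)).1.map Complex.ofReal + Complex.I • (ψ (im x)).1.map Complex.ofReal)
  have hI : ∀ X : Matrix (p ⊕ p) (p ⊕ p) ℂ, Complex.I • Complex.I • X = -X := fun X => by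
    rw [smul_smul, Complex.I_mul_I, neg_one_smul]
  have hsub : ∀ X Y : Matrix (p ⊕ p) (p ⊕ p) ℝ,
      (X - Y).map Complex.ofReal = X.map Complex.ofReal - Y.map Complex.ofReal :=
    fun X Y => by ext; simp
  have hadd : ∀ X Y : Matrix (p ⊕ p) (p ⊕ p) ℝ,
      (X + Y).map Complex.ofReal = X.map Complex.ofReal + Y.map Complex.ofReal :=
    fun X Y => by ext; simp
  rw [h1, h2]
  simp only [Ring.lie_def, hsub, hadd, toC_mul, add_mul, mul_add, smul_mul_assoc, mul_smul_comm,
    hI, smul_add, smul_sub]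
  abel

theorem complexify_injective (ψ : sp l ℝ × sp m ℝ →ₗ⁅ℝ⁆ sp p ℝ) (hψ : Function.Injective ψ) :
    Function.Injective (complexify ψ) := by
  rw [injective_iff_map_eq_zero]
  intro x hx
  have h : ∀ i j, (ψ (re x)).1 i j = 0 ∧ (ψ (im x)).1 i j = 0 := fun i j => by
    have h1 : ((ψ (re x)).1 i j : ℂ) + Complex.I * ((ψ (im x)).1 i j : ℂ) = 0 :=
      congrFun (congrFun hx i) j
    exact ⟨by simpa using congrArg Complex.re h1, by simpa using congrArg Complex.im h1⟩
  have h1 : re x = 0 := hψ (by rw [map_zero]; exact Subtype.ext (by ext i j; exact (h i j).1))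
  have h2 : im x = 0 := hψ (by rw [map_zero]; exact Subtype.ext (by ext i j; exact (h i j).2))
  obtain ⟨a1, a2⟩ := Prod.mk.inj h1
  obtain ⟨b1, b2⟩ := Prod.mk.inj h2
  exact Prod.ext (spMap_re_im_injective a1 b1) (spMap_re_im_injective a2 b2)

theorem map_ofReal_mem_sp {X : Matrix (p ⊕ p) (p ⊕ p) ℝ} (hX : X ∈ sp p ℝ) :
    X.map Complex.ofReal ∈ sp p ℂ := by
  have h := mem_sp_iff_transpose_mul_J.1 hX
  have e : J p ℂ = (J p ℝ).map Complex.ofReal := (map_J p Complex.ofRealHom).symm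
  rw [mem_sp_iff_transpose_mul_J, e, ← transpose_map, ← toC_mul, ← toC_mul, h]
  ext
  simp

theorem complexify_mem_sp (ψ : sp l ℝ × sp m ℝ →ₗ⁅ℝ⁆ sp p ℝ) (x : sp l ℂ × sp m ℂ) :
    complexify ψ x ∈ sp p ℂ := by
  have h1 := mem_sp_iff_transpose_mul_J.1 (map_ofReal_mem_sp (ψ (re x)).2)
  have h2 := mem_sp_iff_transpose_mul_J.1 (map_ofReal_mem_sp (ψ (im x)).2)
  rw [mem_sp_iff_transpose_mul_J]
  change ((ψ (re x)).1.map Complex.ofReal + Complex.I • (ψ (im x)).1.map Complex.ofReal)ᵀ * J p ℂ =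
    -(J p ℂ * ((ψ (re x)).1.map Complex.ofReal + Complex.I • (ψ (im x)).1.map Complex.ofReal))
  rw [transpose_add, transpose_smul, add_mul, smul_mul_assoc, h1, h2, mul_add, mul_smul_comm,
    neg_add, smul_neg]

/-- A symplectic matrix that commutes with a faithful symplectic representation of
`𝔰𝔭(n) × 𝔰𝔭(1)` of dimension `2 (n + 1)` is an involution. -/
theorem symplectic_sq_eq_one {n : ℕ}
    (ψ : sp (Fin n) ℝ × sp (Fin 1) ℝ →ₗ⁅ℝ⁆ sp (Fin (n + 1)) ℝ) (hψ : Function.Injective ψ)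
    (A : symplecticGroup (Fin (n + 1)) ℝ) (hA : ∀ x, Commute A.1 (ψ x).1) : A * A = 1 := by
  by_contra hne
  let p := Fin (n + 1)
  let ι : Matrix (p ⊕ p) (p ⊕ p) ℝ → Matrix (p ⊕ p) (p ⊕ p) ℂ := fun X => X.map Complex.ofReal
  have hinv : Commute A.1 A⁻¹.1 :=
    congrArg Subtype.val ((mul_inv_cancel A).trans (inv_mul_cancel A).symm)
  have hA' : ∀ x, Commute A⁻¹.1 (ψ x).1 := fun x => by
    have h1 : A.1 * A⁻¹.1 = 1 := congrArg Subtype.val (mul_inv_cancel A)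
    have h2 : A⁻¹.1 * A.1 = 1 := congrArg Subtype.val (inv_mul_cancel A)
    calc A⁻¹.1 * (ψ x).1 = A⁻¹.1 * ((ψ x).1 * A.1) * A⁻¹.1 := by
          rw [mul_assoc, mul_assoc, h1, mul_one]
      _ = (ψ x).1 * A⁻¹.1 := by rw [← (hA x).eq, ← mul_assoc, h2, one_mul]
  -- `A` lies in the group; `A - A⁻¹` moves the problem to the Lie algebra and is nonzero exactly
  -- when `A² ≠ 1`.
  set B₀ : Matrix (p ⊕ p) (p ⊕ p) ℝ := A.1 - A⁻¹.1 with hB₀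
  have hB₀mem : B₀ ∈ sp p ℝ := sub_symplectic_inv_mem_sp _ (SymplecticGroup.coe_inv A)
  have hB₀ne : B₀ ≠ 0 := fun h => hne (by
    have h1 : A = A⁻¹ := Subtype.ext (sub_eq_zero.1 h)
    nth_rw 2 [h1]
    exact mul_inv_cancel A)
  let Ω : LinearMap.BilinForm ℂ (p ⊕ p → ℂ) := Matrix.toBilin' (J p ℂ)
  have hΩ : ∀ x y, Ω x y = x ⬝ᵥ J p ℂ *ᵥ y := fun x y => Matrix.toBilin'_apply' _ _ _
  have hanti : ∀ x y, Ω x y = -Ω y x := fun x y => by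
    rw [hΩ, hΩ, dotProduct_mulVec, ← mulVec_transpose, J_transpose, neg_mulVec, neg_dotProduct,
      dotProduct_comm]
  have hskew : ∀ X ∈ sp p ℂ, ∀ x y, Ω (toLin' X x) y = -Ω x (toLin' X y) := fun X hX x y => by
    rw [hΩ, hΩ, toLin'_apply, toLin'_apply, mulVec_mulVec, ← dotProduct_neg, ← neg_mulVec,
      ← mem_sp_iff_transpose_mul_J.1 hX, ← mulVec_mulVec, dotProduct_mulVec x, vecMul_transpose]
  obtain ⟨W, hW, hiso, hWinv⟩ := exists_isotropic_of_skew Ω (toLin' (ι B₀))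
    (fun h => hB₀ne (by
      rw [LinearEquiv.map_eq_zero_iff] at h
      ext i j
      simpa [ι] using congrFun (congrFun h i) j))
    (hskew _ (map_ofReal_mem_sp hB₀mem))
  let Ψ : (sp (Fin n) ℂ × sp (Fin 1) ℂ) →ₗ[ℂ] Module.End ℂ (p ⊕ p → ℂ) :=
    (toLin' : Matrix (p ⊕ p) (p ⊕ p) ℂ ≃ₗ[ℂ] _).toLinearMap ∘ₗ complexify ψ
  have hcomm : ∀ x, Commute (Ψ x) (toLin' (ι B₀)) := fun x => by
    have h1 : ∀ y, ι (ψ y).1 * ι B₀ = ι B₀ * ι (ψ y).1 := fun y => by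
      simp only [ι]
      rw [← toC_mul, ← toC_mul, hB₀, ((hA y).sub_left (hA' y)).eq]
    have h2 : complexify ψ x * ι B₀ = ι B₀ * complexify ψ x := by
      change (ι _ + Complex.I • ι _) * _ = _ * (ι _ + Complex.I • ι _)
      rw [add_mul, mul_add, smul_mul_assoc, mul_smul_comm, h1, h1]
    change toLin' (complexify ψ x) * toLin' (ι B₀) = toLin' (ι B₀) * toLin' (complexify ψ x)
    rw [Module.End.mul_eq_comp, Module.End.mul_eq_comp, ← toLin'_mul, ← toLin'_mul, h2]
  obtain ⟨r, hr1, hr2⟩ := finrank_le_of_isotropic_invariant Ψ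
    (toLin'.injective.comp (complexify_injective ψ hψ))
    (fun x y => by
      change toLin' (complexify ψ ⁅x, y⁆) = toLin' _ * toLin' _ - toLin' _ * toLin' _
      rw [complexify_lie, map_sub, toLin'_mul, toLin'_mul]; rfl)
    -- In a product, each component is tested against elements of its own factor.
    (fun x hx => Prod.ext
      (sp_eq_zero_of_ad_sq_eq_zero _ fun y => congrArg Prod.fst (hx (y, 0)))
      (sp_eq_zero_of_ad_sq_eq_zero _ fun y => congrArg Prod.snd (hx (0, y))))
    Ω (LinearMap.BilinForm.nondegenerate_toBilin'_of_det_ne_zero' _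
      (isUnit_det_J p ℂ).ne_zero) hanti
    (fun X => hskew _ (complexify_mem_sp ψ X)) W (fun X => hWinv _ (hcomm X)) hiso
  have hd : 0 < Module.finrank ℂ W :=
    Module.finrank_pos_iff.2 (Submodule.nontrivial_iff_ne_bot.2 hW)
  have h1 := le_finrank_sp n ℂ
  have h2 := le_finrank_sp 1 ℂ
  rw [Module.finrank_prod] at hr2
  rw [Module.finrank_fintype_fun_eq_card, Fintype.card_sum, Fintype.card_fin] at hr1
  generalize Module.finrank ℂ W = d at *
  -- `Wᗮ/W` has even dimension `r = 2s`, with `d + s = n + 1`.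
  obtain ⟨s, rfl⟩ : ∃ s, r = 2 * s := ⟨n + 1 - d, by omega⟩
  have hch : ∀ a : ℕ, (2 * a + 1).choose 2 = a * (2 * a + 1) := fun a => by
    rw [Nat.choose_two_right, Nat.add_sub_cancel, show (2 * a + 1) * (2 * a) =
      a * (2 * a + 1) * 2 by ring, Nat.mul_div_cancel _ two_pos]
  rw [hch] at h1 h2 hr2
  obtain ⟨e, rfl⟩ : ∃ e, d = e + 1 := ⟨d - 1, by omega⟩
  obtain rfl : n = e + s := by omega
  -- With `d = e + 1` and `n = e + s` the bound reduces to `e² - e + 4es + 2 ≤ 0`, whereas `e² - e +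
  -- 2 = (e - 1)² + e + 1 > 0`.
  nlinarith [Nat.zero_le (e * s), Nat.zero_le e, sq_nonneg ((e : ℤ) - 1)]

end Complexification

/-! ### Finiteness of groups of involutions -/

/-- In a finite-dimensional algebra, a multiplicatively closed set of involutions is finite. -/
theorem finite_of_mul_self_eq_one {K A : Type*} [Field K] [CharZero K] [Ring A] [Algebra K A]
    [FiniteDimensional K A] (S : Set A) (hmul : ∀ a ∈ S, ∀ b ∈ S, a * b ∈ S)
    (hS : ∀ a ∈ S, a * a = 1) : S.Finite := by
  have hcomm : ∀ a ∈ S, ∀ b ∈ S, a * b = b * a := fun a ha b hb => by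
    have h := hS _ (hmul a ha b hb)
    calc a * b = a * ((a * b) * (a * b)) * b := by rw [h, mul_one]
      _ = (a * a) * (b * a) * (b * b) := by noncomm_ring
      _ = b * a := by rw [hS a ha, hS b hb, one_mul, mul_one]
  have := Algebra.isMulCommutative_adjoin K hcomm
  let R := Algebra.adjoin K S
  let _ : CommRing R := { (inferInstance : Ring R) with mul_comm := mul_comm' }
  have : IsArtinianRing R := IsArtinianRing.of_finite K R
  -- The idempotents of a commutative ring correspond to the clopen subsets of its spectrum, which
  -- is finite for an Artinian ring. An involution `a` gives the idempotent `(1 + a) / 2`, which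
  -- determines it.
  have hfin : Finite {e : R | IsIdempotentElem e} :=
    Finite.of_equiv _ (PrimeSpectrum.isIdempotentElemEquivClopens (R := R)).symm.toEquiv
  have hmem : ∀ a : S, (a : A) ∈ R := fun a => Algebra.subset_adjoin a.2
  let f : S → {e : R | IsIdempotentElem e} := fun a => ⟨(2⁻¹ : K) • (1 + ⟨a, hmem a⟩), by
    refine Subtype.ext ?_
    change ((2⁻¹ : K) • (1 + (a : A))) * ((2⁻¹ : K) • (1 + (a : A))) = (2⁻¹ : K) • (1 + (a : A))
    rw [smul_mul_smul_comm, add_mul, one_mul, mul_add, mul_one, hS a a.2, add_comm (a : A) 1,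
      ← two_smul K (1 + (a : A)), smul_smul]
    congr 1
    norm_num⟩
  refine Set.finite_coe_iff.1 (Finite.of_injective f fun a b hab => ?_)
  have h1 := congrArg (fun e => (2 : K) • (e.1.1 : A)) hab
  have h2 : (1 : A) + a = 1 + b := by simpa [f, smul_smul] using h1
  exact Subtype.ext (add_left_cancel h2)

/-! ### The kernel of the covering homomorphism -/

namespace UniversalCover

variable {G : Type*} [TopologicalSpace G] [Group G] [IsTopologicalGroup G]

open scoped unitInterval in
-- For a loop `γ` and a path `δ`, the homotopy `δ(st) γ(t) δ(st)⁻¹ δ(t)` joins `γδ` at `s = 0` to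
-- `δγ` at `s = 1`. It fixes the end points because `γ(0) = γ(1) = 1`.
theorem ker_proj_le_center : (proj G).ker ≤ Subgroup.center (UniversalCover G) := by
  intro x hx
  obtain ⟨γ, rfl⟩ := mk_surjective x
  have hγ1 : γ.1 1 = 1 := hx
  have hγ0 : γ.1 0 = 1 := γ.2
  rw [Subgroup.mem_center_iff]
  intro y
  obtain ⟨δ, rfl⟩ := mk_surjective y
  have hδ0 : δ.1 0 = 1 := δ.2
  rw [← map_mul, ← map_mul]
  symm
  apply mk_eq_mk_of_homotopicRel
  have hc : Continuous fun p : I × I =>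
      δ.1 (p.1 * p.2) * γ.1 p.2 * (δ.1 (p.1 * p.2))⁻¹ * δ.1 p.2 := by fun_prop
  refine ⟨⟨⟨⟨_, hc⟩, fun t => ?_, fun t => ?_⟩, fun s t ht => ?_⟩⟩
  · simp [hδ0]
  · simp
  · rcases ht with rfl | rfl
    · simp [hδ0, hγ0]
    · simp [hγ1]

/-- The kernel of the projection restricted to `Z` has finite index, because the image is finite,
and it is contained in the center. -/
theorem finiteIndex_center_of_finite (Z : Subgroup (UniversalCover G))
    (h : (proj G '' Z).Finite) :
    ((Subgroup.center (UniversalCover G)).subgroupOf Z).FiniteIndex := by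
  let f : Z →* G := (proj G).comp Z.subtype
  have : Finite f.range := (h.subset (by rintro _ ⟨z, rfl⟩; exact ⟨z, z.2, rfl⟩)).to_subtype
  have := Subgroup.finiteIndex_ker f
  refine Subgroup.finiteIndex_of_le (H := f.ker) fun z hz => ?_
  exact ker_proj_le_center hz

end UniversalCover

/-! ### Differential calculus of the Cayley transform -/

section CayleyDerivative

variable {R : Type*} [Ring R]

/-- The Cayley transform plays the role of the exponential map: because of this equivariance,
conjugation is exactly linear in the chart at the identity. -/
theorem cayley_conj {u v A : R} (huv : u * v = 1) (hvu : v * u = 1) (h : IsUnit (1 + A)) :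
    cayley (u * A * v) = u * cayley A * v := by
  have e : 1 + u * A * v = u * (1 + A) * v := by rw [mul_add, add_mul, mul_one, huv]
  have hu : IsUnit u := ⟨⟨u, v, huv, hvu⟩, rfl⟩
  have hv : IsUnit v := ⟨⟨v, u, hvu, huv⟩, rfl⟩
  have h' : IsUnit (1 + u * A * v) := e ▸ (hu.mul h).mul hv
  refine h'.mul_right_cancel ?_
  rw [cayley_mul h', e]
  calc 1 - u * A * v = u * (cayley A * (1 + A)) * v := by
        rw [cayley_mul h, mul_sub, sub_mul, mul_one, huv]
    _ = u * cayley A * (v * u) * (1 + A) * v := by rw [hvu]; noncomm_ring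
    _ = _ := by noncomm_ring

theorem cayley_mul_cayley_neg {A : R} (h : IsUnit (1 + A)) (h' : IsUnit (1 - A)) :
    cayley A * cayley (-A) = 1 := by
  have h1 : cayley (-A) = (1 + A) * Ring.inverse (1 - A) := by
    rw [cayley, sub_neg_eq_add, ← sub_eq_add_neg]
  rw [h1, ← mul_assoc, cayley_mul h, Ring.mul_inverse_cancel _ h']

variable {R : Type*} [NormedRing R] [NormedAlgebra ℝ R] [CompleteSpace R]

/-- To first order `(1 - A)(1 + A)⁻¹ = 1 - 2A`; this is the origin of every factor `-2` below. -/
theorem hasFDerivAt_cayley_zero :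
    HasFDerivAt (cayley : R → R) ((-2 : ℝ) • ContinuousLinearMap.id ℝ R) 0 := by
  have h0 := hasFDerivAt_ringInverse (𝕜 := ℝ) (1 : Rˣ)
  rw [Units.val_one, ← add_zero (1 : R)] at h0
  have h2 := HasFDerivAt.comp (0 : R) h0 ((hasFDerivAt_id (𝕜 := ℝ) (0 : R)).const_add 1)
  have h3 := ((hasFDerivAt_id (𝕜 := ℝ) (0 : R)).const_sub 1).mul' h2
  refine h3.congr_fderiv (ContinuousLinearMap.ext fun X => ?_)
  simp
  rw [two_smul, neg_add]

theorem HasDerivAt.cayley {f : ℝ → R} {f' : R} {t : ℝ} (hf : HasDerivAt f f' t) (h0 : f t = 0) :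
    HasDerivAt (fun s => _root_.cayley (f s)) ((-2 : ℝ) • f') t := by
  have := HasFDerivAt.comp_hasDerivAt (f := f) t (h0 ▸ hasFDerivAt_cayley_zero) hf
  exact this

theorem hasDerivAt_cayley_conj (X Y : R) :
    HasDerivAt (fun s : ℝ => cayley (s • X) * Y * cayley (-(s • X)))
      ((-2 : ℝ) • (X * Y - Y * X)) 0 := by
  have h : HasDerivAt (fun s : ℝ => s • X) X 0 := by
    simpa using (hasDerivAt_id (0 : ℝ)).smul_const X
  have h1 := ((h.cayley (zero_smul _ _)).mul_const Y).mul (h.neg.cayley (by simp))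
  refine h1.congr_deriv ?_
  simp [cayley_zero, sub_eq_add_neg]

/-- The derivative at the identity of a conjugation by a Cayley transform. -/
theorem deriv_eq_of_eventually_conj_cayley {a f : ℝ → R} {a' f' b : R} (ha : HasDerivAt a a' 0)
    (hf : HasDerivAt f f' 0) (hf0 : f 0 = 0) (ha0 : a 0 = b)
    (h : ∀ᶠ s in nhds (0 : ℝ), a s * cayley (f s) = cayley (f s) * b) :
    a' = (-2 : ℝ) • (f' * b - b * f') := by
  have h1 := ha.mul (hf.cayley hf0)
  have h2 := (hf.cayley hf0).mul_const b
  have h3 := (h1.congr_of_eventuallyEq (h.mono fun s hs => hs.symm)).unique h2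
  simp only [hf0, ha0, cayley_zero, mul_one, mul_smul_comm, smul_mul_assoc] at h3
  rw [smul_sub, ← h3]
  abel

end CayleyDerivative

/-! ### The adjoint action in the Cayley chart -/

namespace SpCover

open scoped Matrix
variable {n : ℕ}

instance : IsScalarTower ℝ (SpOp n) (SpOp n) := ⟨fun _ _ _ => rfl⟩

instance : SMulCommClass ℝ (SpOp n) (SpOp n) :=
  ⟨fun c X Y => ContinuousLinearMap.ext fun v => (map_smul X c (Y v)).symm⟩

theorem projOp_one : projOp (1 : SpCover n) = 1 := by simp [projOp]

theorem projOp_mul_projOp_inv (g : SpCover n) : projOp g * projOp g⁻¹ = 1 := by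
  rw [← projOp_mul, mul_inv_cancel, projOp_one]

theorem projOp_inv_mul_projOp (g : SpCover n) : projOp g⁻¹ * projOp g = 1 := by
  rw [← projOp_mul, inv_mul_cancel, projOp_one]

theorem chart_one_apply (x : SpCover n) : chart 1 x = spProj n (cayley (projOp x)) := by
  rw [chart_apply, inv_one, projOp_one, one_mul]

theorem chart_one_one : chart (1 : SpCover n) 1 = 0 := by
  rw [chart_one_apply, projOp_one]
  simp [cayley]

/-- The adjoint action, restricted to the Lie algebra by means of the projection. -/
noncomputable def Ad (g : SpCover n) : SpLie n →L[ℝ] SpLie n :=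
  LinearMap.toContinuousLinearMap
    { toFun := fun X => spProj n (projOp g * (X : SpOp n) * projOp g⁻¹)
      map_add' := fun X Y => by simp only [map_add, mul_add, add_mul]
      map_smul' := fun c X => by
        simp only [map_smul, mul_smul_comm, smul_mul_assoc, RingHom.id_apply] }

theorem Ad_apply (g : SpCover n) (X : SpLie n) :
    Ad g X = spProj n (projOp g * (X : SpOp n) * projOp g⁻¹) := rfl

theorem chart_one_symm_zero : (chart (1 : SpCover n)).symm 0 = 1 := by
  rw [← chart_one_one, (chart 1).left_inv (mem_chart_source 1)]

theorem continuousAt_chart_one_symm : ContinuousAt (chart (1 : SpCover n)).symm 0 :=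
  (chart 1).continuousAt_symm (chart_one_one (n := n) ▸ (chart 1).map_source (mem_chart_source 1))

theorem ball_mem_nhds_zero : (chart (1 : SpCover n)).target ∈ nhds 0 :=
  Metric.isOpen_ball.mem_nhds (Metric.mem_ball_self one_pos)

/-- Conjugation corresponds to the adjoint action in the chart at the identity. -/
theorem eventually_conj_chart_symm (g : SpCover n) : ∀ᶠ X in nhds (0 : SpLie n),
    g * (chart 1).symm X * g⁻¹ ∈ (chart (1 : SpCover n)).source ∧
      chart 1 (g * (chart 1).symm X * g⁻¹) = Ad g X := by
  have hc : ContinuousAt (fun X : SpLie n => g * (chart 1).symm X * g⁻¹) 0 :=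
    (continuousAt_const.mul continuousAt_chart_one_symm).mul continuousAt_const
  have h1 : (chart (1 : SpCover n)).source ∈ nhds (g * (chart 1).symm (0 : SpLie n) * g⁻¹) := by
    rw [chart_one_symm_zero, mul_one, mul_inv_cancel]
    exact (chart 1).open_source.mem_nhds (mem_chart_source 1)
  filter_upwards [hc.eventually_mem h1, ball_mem_nhds_zero] with X hX hX'
  refine ⟨hX, ?_⟩
  have hu := isUnit_one_add_of_mem_ball hX'
  rw [chart_one_apply, projOp_mul, projOp_mul, projOp_chart_symm 1 hX', projOp_one, one_mul,
    cayley_conj (projOp_mul_projOp_inv g) (projOp_inv_mul_projOp g) (isUnit_one_add_cayley hu),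
    cayley_cayley hu, Ad_apply]

/-- Conjugation by a symplectic matrix preserves skew-adjointness, its inverse being its adjoint.
Hence the projection in the definition of `Ad` changes nothing (`coe_Ad`). -/
theorem conj_mem_spSubmodule (g : SpCover n) (X : SpLie n) :
    projOp g * (X : SpOp n) * projOp g⁻¹ ∈ spSubmodule n := by
  have hX := mem_sp_iff.1 (mem_spSubmodule.1 X.2)
  have hJ := Matrix.J_squared (Fin n) ℝ
  set A := (UniversalCover.proj (Sp n) g).1
  set A' := (UniversalCover.proj (Sp n) g⁻¹).1 with hA'
  rw [map_inv, SymplecticGroup.coe_inv] at hA'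
  have h1 : Aᵀ * Matrix.J (Fin n) ℝ = Matrix.J (Fin n) ℝ * A' := by
    rw [hA', ← mul_assoc, ← mul_assoc, mul_neg, hJ]; simp [A]
  have h2 : A'ᵀ * Matrix.J (Fin n) ℝ = Matrix.J (Fin n) ℝ * A := by
    rw [hA', Matrix.transpose_mul, Matrix.transpose_mul, Matrix.transpose_neg, Matrix.J_transpose,
      Matrix.transpose_transpose]
    simp [mul_assoc, hJ, A]
  have h3 : projOp g * (X : SpOp n) * projOp g⁻¹ = toOp n (A * (toOp n).symm X * A') := by
    rw [map_mul, map_mul, AlgEquiv.apply_symm_apply]; rfl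
  rw [h3, mem_spSubmodule, AlgEquiv.symm_apply_apply, mem_sp_iff, Matrix.transpose_mul,
    Matrix.transpose_mul]
  set Y := (toOp n).symm (SpLie.incl n X) with hY
  have hX' : Yᵀ * Matrix.J (Fin n) ℝ = -(Matrix.J (Fin n) ℝ * Y) := hX
  calc A'ᵀ * (Yᵀ * Aᵀ) * Matrix.J (Fin n) ℝ = A'ᵀ * (Yᵀ * (Aᵀ * Matrix.J (Fin n) ℝ)) := by
        noncomm_ring
    _ = A'ᵀ * ((Yᵀ * Matrix.J (Fin n) ℝ) * A') := by rw [h1]; noncomm_ring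
    _ = -(A'ᵀ * Matrix.J (Fin n) ℝ * Y * A') := by rw [hX']; noncomm_ring
    _ = _ := by rw [h2]; noncomm_ring

theorem coe_Ad (g : SpCover n) (X : SpLie n) :
    (Ad g X : SpOp n) = projOp g * (X : SpOp n) * projOp g⁻¹ := by
  rw [Ad_apply]
  exact spProj_of_mem (conj_mem_spSubmodule g X)

end SpCover

/-! ### The differential of a homomorphism at the identity -/

namespace SpCover

variable {n m p : ℕ}

/-- A homomorphism in the charts at the identity. -/
noncomputable def localRep (ρ : SpCover n × SpCover m →* SpCover p) (X : SpLie n × SpLie m) :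
    SpLie p :=
  chart 1 (ρ ((chart 1).symm X.1, (chart 1).symm X.2))

/-- The preferred charts at the identity are the Cayley charts, so `mfderiv` at `1` is the Fréchet
derivative of `localRep ρ` at `0`. The immersion hypothesis enters only at this point. -/
theorem exists_hasFDerivAt_localRep (ρ : SpCover n × SpCover m →* SpCover p)
    (hρ : ContMDiff (𝓘(ℝ, SpLie n).prod 𝓘(ℝ, SpLie m)) 𝓘(ℝ, SpLie p) ∞ ρ)
    (himm : ∀ x, Function.Injective
      (mfderiv (𝓘(ℝ, SpLie n).prod 𝓘(ℝ, SpLie m)) 𝓘(ℝ, SpLie p) ρ x)) :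
    ∃ L : SpLie n × SpLie m →L[ℝ] SpLie p, Function.Injective L ∧
      HasFDerivAt (localRep ρ) L 0 := by
  have h := ((hρ.mdifferentiable (by simp)) (1 : SpCover n × SpCover m)).hasMFDerivAt
  refine ⟨_, himm 1, ?_⟩
  have h2 := h.2
  have e1 : extChartAt (𝓘(ℝ, SpLie n).prod 𝓘(ℝ, SpLie m)) (1 : SpCover n × SpCover m) 1 = 0 :=
    Prod.ext (chart_one_one (n := n)) (chart_one_one (n := m))
  have e2 : writtenInExtChartAt (𝓘(ℝ, SpLie n).prod 𝓘(ℝ, SpLie m)) 𝓘(ℝ, SpLie p)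
      (1 : SpCover n × SpCover m) ρ = localRep ρ := by
    funext X
    have e3 : writtenInExtChartAt (𝓘(ℝ, SpLie n).prod 𝓘(ℝ, SpLie m)) 𝓘(ℝ, SpLie p)
      (1 : SpCover n × SpCover m) ρ X = chart (ρ 1)
        (ρ ((chart 1).symm X.1, (chart 1).symm X.2)) := rfl
    rw [e3, map_one]
    rfl
  rw [e1, e2, ModelWithCorners.range_eq_univ] at h2
  exact hasFDerivWithinAt_univ.1 h2

variable {ρ : SpCover n × SpCover m →* SpCover p} {L : SpLie n × SpLie m →L[ℝ] SpLie p}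

theorem localRep_zero : localRep ρ 0 = 0 := by
  have : ((chart (1 : SpCover n)).symm (0 : SpLie n × SpLie m).1,
      (chart (1 : SpCover m)).symm (0 : SpLie n × SpLie m).2) = (1 : SpCover n × SpCover m) :=
    Prod.ext chart_one_symm_zero chart_one_symm_zero
  rw [localRep, this, map_one, chart_one_one]

theorem eventually_chart_symm_localRep (hρ : Continuous ρ) : ∀ᶠ X in nhds (0 : SpLie n × SpLie m),
    localRep ρ X ∈ (chart (1 : SpCover p)).target ∧
      (chart 1).symm (localRep ρ X) = ρ ((chart 1).symm X.1, (chart 1).symm X.2) := by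
  have h1 : ContinuousAt (fun X : SpLie n × SpLie m =>
      ρ ((chart 1).symm X.1, (chart 1).symm X.2)) 0 := by
    refine hρ.continuousAt.comp (ContinuousAt.prodMk ?_ ?_)
    · exact ContinuousAt.comp (f := Prod.fst) continuousAt_chart_one_symm continuousAt_fst
    · exact ContinuousAt.comp (f := Prod.snd) continuousAt_chart_one_symm continuousAt_snd
  have h2 : (chart (1 : SpCover p)).source ∈
      nhds (ρ ((chart 1).symm (0 : SpLie n × SpLie m).1, (chart 1).symm (0 : SpLie n × SpLie m).2)) := by
    have : ((chart (1 : SpCover n)).symm (0 : SpLie n × SpLie m).1,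
      (chart (1 : SpCover m)).symm (0 : SpLie n × SpLie m).2) = (1 : SpCover n × SpCover m) :=
      Prod.ext chart_one_symm_zero chart_one_symm_zero
    rw [this, map_one]
    exact (chart 1).open_source.mem_nhds (mem_chart_source 1)
  filter_upwards [h1.eventually_mem h2] with X hX
  exact ⟨(chart 1).map_source hX, (chart 1).left_inv hX⟩

theorem eventually_Ad_localRep (hρ : Continuous ρ) (hL : HasFDerivAt (localRep ρ) L 0)
    (k : SpCover p) : ∀ᶠ X in nhds (0 : SpLie n × SpLie m), Ad k (localRep ρ X) =
      chart 1 (k * ρ ((chart 1).symm X.1, (chart 1).symm X.2) * k⁻¹) := by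
  have h1 : Filter.Tendsto (localRep ρ) (nhds 0) (nhds 0) := by
    have := hL.continuousAt.tendsto
    rwa [localRep_zero] at this
  filter_upwards [h1.eventually (eventually_conj_chart_symm k),
    eventually_chart_symm_localRep hρ] with X h2 h3
  rw [← h2.2, h3.2]

theorem hasFDerivAt_Ad_localRep (hL : HasFDerivAt (localRep ρ) L 0) (k : SpCover p) :
    HasFDerivAt (fun X => Ad k (localRep ρ X)) (Ad k ∘L L) 0 :=
  (Ad k).hasFDerivAt.comp 0 hL

/-- The differential of a homomorphism intertwines the adjoint actions. -/
theorem map_Ad (hρ : Continuous ρ) (hL : HasFDerivAt (localRep ρ) L 0) (g : SpCover n)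
    (h : SpCover m) (X : SpLie n × SpLie m) : L (Ad g X.1, Ad h X.2) = Ad (ρ (g, h)) (L X) := by
  have h1 : HasFDerivAt (fun X : SpLie n × SpLie m => localRep ρ ((Ad g).prodMap (Ad h) X))
      (L ∘L (Ad g).prodMap (Ad h)) 0 := by
    refine HasFDerivAt.comp (g := localRep ρ) 0 ?_ ((Ad g).prodMap (Ad h)).hasFDerivAt
    rwa [map_zero]
  have hfst : Filter.Tendsto Prod.fst (nhds (0 : SpLie n × SpLie m)) (nhds 0) :=
    continuous_fst.tendsto' _ _ rfl
  have hsnd : Filter.Tendsto Prod.snd (nhds (0 : SpLie n × SpLie m)) (nhds 0) :=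
    continuous_snd.tendsto' _ _ rfl
  -- In the charts, `ρ` intertwines conjugation by `(g, h)` with conjugation by `ρ (g, h)`. Both
  -- conjugations are linear there, so uniqueness of the derivative gives the claim.
  have h2 : (fun X : SpLie n × SpLie m => localRep ρ ((Ad g).prodMap (Ad h) X)) =ᶠ[nhds 0]
      fun X => Ad (ρ (g, h)) (localRep ρ X) := by
    filter_upwards [eventually_Ad_localRep hρ hL (ρ (g, h)),
      hfst.eventually (eventually_conj_chart_symm g),
      hsnd.eventually (eventually_conj_chart_symm h)] with Y e1 e2 e3
    rw [e1, ← map_inv, ← map_mul, ← map_mul, localRep]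
    change chart 1 (ρ ((chart 1).symm (Ad g Y.1), (chart 1).symm (Ad h Y.2))) = _
    rw [← e2.2, ← e3.2, (chart 1).left_inv e2.1, (chart 1).left_inv e3.1]
    rfl
  have h3 := (h1.congr_of_eventuallyEq h2.symm).unique (hasFDerivAt_Ad_localRep hL (ρ (g, h)))
  exact DFunLike.congr_fun h3 X

/-- An element of the centralizer of the image acts trivially on the image of the differential. -/
theorem Ad_eq_of_mem_centralizer (hρ : Continuous ρ) (hL : HasFDerivAt (localRep ρ) L 0)
    {z : SpCover p} (hz : z ∈ Subgroup.centralizer (Set.range ρ)) (X : SpLie n × SpLie m) :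
    Ad z (L X) = L X := by
  have h2 : localRep ρ =ᶠ[nhds 0] fun X => Ad z (localRep ρ X) := by
    filter_upwards [eventually_Ad_localRep hρ hL z] with Y e1
    rw [e1, ← Subgroup.mem_centralizer_iff.1 hz _ (Set.mem_range_self _), mul_inv_cancel_right]
    rfl
  have h3 := (hL.congr_of_eventuallyEq h2.symm).unique (hasFDerivAt_Ad_localRep hL z)
  exact (DFunLike.congr_fun h3 X).symm

theorem projOp_chart_one_symm {X : SpLie n} (hX : X ∈ (chart (1 : SpCover n)).target) :
    projOp ((chart 1).symm X) = cayley (X : SpOp n) := by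
  rw [projOp_chart_symm 1 hX, projOp_one, one_mul]

theorem eventually_mem_target (X : SpLie n) :
    ∀ᶠ s in nhds (0 : ℝ), s • X ∈ (chart (1 : SpCover n)).target := by
  have h : Filter.Tendsto (fun s : ℝ => s • X) (nhds 0) (nhds 0) :=
    (by fun_prop : Continuous fun s : ℝ => s • X).tendsto' _ _ (zero_smul _ _)
  exact h.eventually_mem ball_mem_nhds_zero

/-- The derivative of the adjoint action is the commutator, up to the factor `-2` which is due to
the Cayley transform. -/
theorem hasDerivAt_Ad (X Y : SpLie n) :
    HasDerivAt (fun s : ℝ => Ad ((chart 1).symm (s • X)) Y)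
      ((-2 : ℝ) • spProj n ((X : SpOp n) * (Y : SpOp n) - (Y : SpOp n) * (X : SpOp n))) 0 := by
  have h1 := (spProj n).hasFDerivAt.comp_hasDerivAt (0 : ℝ)
    (hasDerivAt_cayley_conj (X : SpOp n) (Y : SpOp n))
  rw [map_smul] at h1
  refine h1.congr_of_eventuallyEq ?_
  filter_upwards [eventually_mem_target X] with s hs
  have hu := isUnit_one_add_of_mem_ball hs
  have hu' : IsUnit (1 - (SpLie.incl n (s • X))) := by
    have : -(s • X) ∈ Metric.ball (0 : SpLie n) 1 := by
      rw [mem_ball_zero_iff, norm_neg, ← mem_ball_zero_iff]; exact hs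
    have := isUnit_one_add_of_mem_ball this
    rwa [map_neg, ← sub_eq_add_neg] at this
  have e : projOp ((chart 1).symm (s • X))⁻¹ = cayley (-(SpLie.incl n (s • X))) := by
    have e1 := projOp_inv_mul_projOp ((chart 1).symm (s • X))
    rw [projOp_chart_one_symm hs] at e1
    calc projOp ((chart 1).symm (s • X))⁻¹ = projOp ((chart 1).symm (s • X))⁻¹ *
          (cayley (SpLie.incl n (s • X)) * cayley (-(SpLie.incl n (s • X)))) := by
          rw [cayley_mul_cayley_neg hu hu', mul_one]
      _ = _ := by rw [← mul_assoc, e1, one_mul]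
  rw [Ad_apply, e, projOp_chart_one_symm hs, map_smul]
  rfl

/-- The differential of a homomorphism preserves commutators. -/
theorem map_commutator (hρ : Continuous ρ) (hL : HasFDerivAt (localRep ρ) L 0)
    (X Y : SpLie n × SpLie m) :
    SpLie.incl p (L (spProj n ((X.1 : SpOp n) * (Y.1 : SpOp n) - (Y.1 : SpOp n) * (X.1 : SpOp n)),
      spProj m ((X.2 : SpOp m) * (Y.2 : SpOp m) - (Y.2 : SpOp m) * (X.2 : SpOp m)))) =
      SpLie.incl p (L X) * SpLie.incl p (L Y) - SpLie.incl p (L Y) * SpLie.incl p (L X) := by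
  have ha := (SpLie.incl p ∘L L).hasFDerivAt.comp_hasDerivAt (0 : ℝ)
    ((hasDerivAt_Ad X.1 Y.1).prodMk (hasDerivAt_Ad X.2 Y.2))
  have hlin : HasDerivAt (fun s : ℝ => s • X) X 0 := by
    simpa using (hasDerivAt_id (0 : ℝ)).smul_const X
  have hr : HasDerivAt (fun s : ℝ => localRep ρ (s • X)) (L X) 0 := by
    have hL' : HasFDerivAt (localRep ρ) L ((0 : ℝ) • X) := by rwa [zero_smul]
    exact hL'.comp_hasDerivAt (0 : ℝ) hlin
  have hf := (SpLie.incl p).hasFDerivAt.comp_hasDerivAt (0 : ℝ) hr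
  have h0 : Filter.Tendsto (fun s : ℝ => s • X) (nhds 0) (nhds 0) :=
    (by fun_prop : Continuous fun s : ℝ => s • X).tendsto' _ _ (zero_smul _ _)
  have hAd1 : ∀ {q : ℕ} (Z : SpLie q), Ad 1 Z = Z := fun Z => by
    rw [Ad_apply, inv_one, projOp_one, one_mul, mul_one, spProj_coe]
  -- The identity of `map_Ad` along the curve `s ↦ (chart 1).symm (s • X)` is differentiated at `s =
  -- 0`. Both sides acquire the factor `-2`, which cancels.
  have key := deriv_eq_of_eventually_conj_cayley (b := SpLie.incl p (L Y)) ha hf ?_ ?_ ?_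
  · have h2 : (-2 : ℝ) ≠ 0 := by norm_num
    refine smul_right_injective (SpOp p) h2 ?_
    refine Eq.trans ?_ key
    rw [← Prod.smul_mk, map_smul]
    rfl
  · simp [localRep_zero]
  · simp [chart_one_symm_zero, hAd1]
  · filter_upwards [h0.eventually (eventually_chart_symm_localRep hρ)] with s hs
    have e1 := map_Ad hρ hL ((chart 1).symm (s • X.1)) ((chart 1).symm (s • X.2)) Y
    have e2 := coe_Ad (ρ ((chart 1).symm (s • X.1), (chart 1).symm (s • X.2))) (L Y)
    have e3 : ρ ((chart 1).symm (s • X.1), (chart 1).symm (s • X.2)) =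
      (chart 1).symm (localRep ρ (s • X)) := hs.2.symm
    change SpLie.incl p (L _) * cayley (SpLie.incl p (localRep ρ (s • X))) = _
    rw [e1, e2, ← projOp_chart_one_symm hs.1, ← e3, mul_assoc, projOp_inv_mul_projOp, mul_one, e3,
      projOp_chart_one_symm hs.1]
    rfl

end SpCover

/-! ### The differential as a homomorphism of matrix Lie algebras -/

section LieHom

open LieAlgebra.Symplectic SpCover

/-- The operators in `SpLie n` as matrices. -/
noncomputable def spEquiv (n : ℕ) : SpLie n ≃ₗ[ℝ] sp (Fin n) ℝ where
  toFun X := ⟨(toOp n).symm (SpLie.incl n X), X.2⟩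
  invFun Y := ⟨toOp n Y.1, by
    rw [mem_spSubmodule, AlgEquiv.symm_apply_apply]
    exact Y.2⟩
  map_add' X Y := Subtype.ext (by
    change (toOp n).symm (SpLie.incl n (X + Y)) =
      (toOp n).symm (SpLie.incl n X) + (toOp n).symm (SpLie.incl n Y)
    rw [map_add, map_add])
  map_smul' c X := Subtype.ext (by
    change (toOp n).symm (SpLie.incl n (c • X)) = c • (toOp n).symm (SpLie.incl n X)
    rw [map_smul, map_smul])
  left_inv X := Subtype.ext ((toOp n).apply_symm_apply _)
  right_inv Y := Subtype.ext ((toOp n).symm_apply_apply _)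

theorem incl_spEquiv_symm {n : ℕ} (x : sp (Fin n) ℝ) :
    SpLie.incl n ((spEquiv n).symm x) = toOp n x.1 := rfl

theorem spEquiv_symm_lie {n : ℕ} (x y : sp (Fin n) ℝ) : (spEquiv n).symm ⁅x, y⁆ =
    spProj n (SpLie.incl n ((spEquiv n).symm x) * SpLie.incl n ((spEquiv n).symm y) -
      SpLie.incl n ((spEquiv n).symm y) * SpLie.incl n ((spEquiv n).symm x)) := by
  have h : SpLie.incl n ((spEquiv n).symm ⁅x, y⁆) =
      SpLie.incl n ((spEquiv n).symm x) * SpLie.incl n ((spEquiv n).symm y) -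
        SpLie.incl n ((spEquiv n).symm y) * SpLie.incl n ((spEquiv n).symm x) := by
    simp only [incl_spEquiv_symm]
    rw [← map_mul, ← map_mul, ← map_sub]
    rfl
  rw [← h, spProj_coe]

/-- The differential at the identity of a homomorphism, as a homomorphism of Lie algebras. -/
noncomputable def differential {n m p : ℕ} {ρ : SpCover n × SpCover m →* SpCover p}
    {L : SpLie n × SpLie m →L[ℝ] SpLie p} (hρ : Continuous ρ)
    (hL : HasFDerivAt (localRep ρ) L 0) :
    sp (Fin n) ℝ × sp (Fin m) ℝ →ₗ⁅ℝ⁆ sp (Fin p) ℝ :=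
  { (spEquiv p).toLinearMap ∘ₗ L.toLinearMap ∘ₗ
      ((spEquiv n).symm.prodCongr (spEquiv m).symm).toLinearMap with
    map_lie' := fun {x y} => by
      refine (spEquiv p).symm.injective ?_
      rw [spEquiv_symm_lie]
      simp only [AddHom.toFun_eq_coe, LinearMap.coe_toAddHom, LinearMap.coe_comp,
        LinearEquiv.coe_coe, ContinuousLinearMap.coe_coe, Function.comp_apply,
        LinearEquiv.symm_apply_apply, LinearEquiv.prodCongr_apply]
      rw [← map_commutator hρ hL, spProj_coe, ← spEquiv_symm_lie, ← spEquiv_symm_lie]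
      rfl }

theorem differential_apply {n m p : ℕ} {ρ : SpCover n × SpCover m →* SpCover p}
    {L : SpLie n × SpLie m →L[ℝ] SpLie p} (hρ : Continuous ρ)
    (hL : HasFDerivAt (localRep ρ) L 0) (x : sp (Fin n) ℝ × sp (Fin m) ℝ) :
    (differential hρ hL x).1 =
      (toOp p).symm (SpLie.incl p (L ((spEquiv n).symm x.1, (spEquiv m).symm x.2))) := rfl

theorem differential_injective {n m p : ℕ} {ρ : SpCover n × SpCover m →* SpCover p}
    {L : SpLie n × SpLie m →L[ℝ] SpLie p} (hρ : Continuous ρ)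
    (hL : HasFDerivAt (localRep ρ) L 0) (hinj : Function.Injective L) :
    Function.Injective (differential hρ hL) :=
  (spEquiv p).injective.comp
    (hinj.comp ((spEquiv n).symm.prodCongr (spEquiv m).symm).injective)

end LieHom

/-! ### The centralizer of the image -/

theorem mainTheorem8 (n : ℕ) (hn : 1 ≤ n)
    (ρ : SpCover n × SpCover 1 →* SpCover (n + 1))
    (hρ : ContMDiff (𝓘(ℝ, SpLie n).prod 𝓘(ℝ, SpLie 1)) 𝓘(ℝ, SpLie (n + 1)) ∞ ρ)
    (himm : ∀ x, Function.Injective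
      (mfderiv (𝓘(ℝ, SpLie n).prod 𝓘(ℝ, SpLie 1)) 𝓘(ℝ, SpLie (n + 1)) ρ x)) :
    Subgroup.center (SpCover (n + 1)) ≤ Subgroup.centralizer (Set.range ρ) ∧
      ((Subgroup.center (SpCover (n + 1))).subgroupOf
        (Subgroup.centralizer (Set.range ρ))).FiniteIndex := by
  refine ⟨Subgroup.center_le_centralizer _, ?_⟩
  obtain ⟨L, hinj, hL⟩ := SpCover.exists_hasFDerivAt_localRep ρ hρ himm
  have hc := hρ.continuous
  apply UniversalCover.finiteIndex_center_of_finite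
  set Z := Subgroup.centralizer (Set.range ρ)
  have hsq : ∀ z ∈ Z, UniversalCover.proj (Sp (n + 1)) z * UniversalCover.proj (Sp (n + 1)) z = 1 :=
    fun z hz => by
    refine symplectic_sq_eq_one (differential hc hL) (differential_injective hc hL hinj) _
      fun x => ?_
    rw [differential_apply]
    set X : SpLie n × SpLie 1 := ((spEquiv n).symm x.1, (spEquiv 1).symm x.2)
    have h1 := SpCover.coe_Ad z (L X)
    rw [SpCover.Ad_eq_of_mem_centralizer hc hL hz] at h1
    have h2 : Commute (SpCover.projOp z) (SpLie.incl (n + 1) (L X)) := by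
      -- `Ad z` fixes `L X`; multiplying by `projOp z` on the right turns this into commutation.
      have h3 := congrArg (· * SpCover.projOp z) h1
      simp only [mul_assoc, SpCover.projOp_inv_mul_projOp, mul_one] at h3
      exact h3.symm
    have h4 := h2.map (toOp (n + 1)).symm
    rwa [SpCover.projOp, AlgEquiv.symm_apply_apply] at h4
  -- Finiteness is proved in the algebra of real matrices, where `finite_of_mul_self_eq_one`
  -- applies.
  refine Set.Finite.of_finite_image (f := Subtype.val) ?_ Subtype.val_injective.injOn
  refine finite_of_mul_self_eq_one (K := ℝ) _ ?_ ?_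
  · rintro _ ⟨_, ⟨z, hz, rfl⟩, rfl⟩ _ ⟨_, ⟨w, hw, rfl⟩, rfl⟩
    exact ⟨_, ⟨z * w, Z.mul_mem hz hw, rfl⟩, by rw [map_mul]; rfl⟩
  · rintro _ ⟨_, ⟨z, hz, rfl⟩, rfl⟩
    exact congrArg Subtype.val (hsq z hz)
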